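/- Let $X$ be a finite-dimensional real Hilbert space, $T>0$, and $\mathcal E:[0,T]\times X\to\mathbb R$, $(t,u)\mapsto\mathcal E_t(u)$, with differential $D\mathcal E_t$ in $u$ and power $\partial_t\mathcal E_t$. Put $\mathcal C(t)=\{u\in X: D\mathcal E_t(u)=0\}$. Assume: (E$_0$) $\mathcal E\in C^1([0,T]\times X)$; (E$_1$) for every $\rho>0$ the set $\{u\in X:\sup_{t\in[0,T]}|\mathcal E_t(u)|\le\rho\}$ is bounded; (E$_2$) there are $C_1,C_2>0$ with $|\partial_t\mathcal E_t(u)|\le C_1\mathcal E_t(u)+C_2$ for all $(t,u)\in[0,T]\times X$; (E$_3$) for every $t\in[0,T]$ the set $\mathcal C(t)$ consists of isolated points. *Cost.* For $t\in[0,T]$ and $u_1\ne u_2$ in $X$, a curve $\vartheta\in C([0,1];X)$ with $\vartheta(0)=u_1$, $\vartheta(1)=u_2$ is admissible if there is a partition $0=\mathsf t_0<\mathsf t_1<\dots<\mathsf t_j=1$ such that $\vartheta$ is locally Lipschitz on each $(\mathsf t_i,\mathsf t_{i+1})$, $\vartheta(\mathsf t_i)\in\mathcal C(t)$ for $1\le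 i\le j-1$, and $\vartheta(r)\notin\mathcal C(t)$ for all $r\in(\mathsf t_i,\mathsf t_{i+1})$, $0\le i\le j-1$. Let $\mathsf c(t;u_1,u_2)\in[0,\infty]$ be the infimum of $\int_0^1\|D\mathcal E_t(\vartheta(s))\|\,\|\vartheta'(s)\|\,ds$ over all admissible $\vartheta$ (with $\inf\emptyset=+\infty$) if $u_1\neq u_2$, and $\mathsf c(t;u_1,u_1)=0$. *Dissipative Viscosity solutions.* A bounded measurable, everywhere defined $u:[0,T]\to X$ is a Dissipative Viscosity solution if the left limits $u_-(s)$, $0<s\le T$, and the right limits $u_+(t)$, $0\le t<T$, exist and, with $u_-(0):=u(0)$ and $u_+(T):=u(T)$, there is a finite positive Borel measure $\mu$ on $[0,T]$ whose set of atoms $J$ is countable, such that 1. $\mu([s,t])+\mathcal E_t(u_+(t))=\mathcal E_s(u_-(s))+\int_s^t\partial_t\mathcal E_r(u(r))\,dr$ for all $0\le s\le t\le T$; 2. $u$ is continuous at every point of $[0,T]\setminus J$, and $u(t)\in\mathcal C(t)$ for all $t\in(0,T]\setminus J$; 3. $u_-(s)\in\mathcal C(s)$ for $0<s\le T$ and $u_+(t)\in\mathcal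 C(t)$ for $0\le t<T$; $J=\{t\in[0,T]:u_-(t)\ne u_+(t)\}$; and $0<\mathsf c(t;u_-(t),u_+(t))=\mu(\{t\})=\mathcal E_t(u_-(t))-\mathcal E_t(u_+(t))$ for every $t\in J$. **Theorem.** Let $\varepsilon_n>0$, $\varepsilon_n\to0$, let $u^0_n\to u_0$ in $X$, and for each $n$ let $u_n\in H^1(0,T;X)$ be a solution of $\varepsilon_n u_n'(t)+D\mathcal E_t(u_n(t))=0$ for a.e. $t\in(0,T)$ with $u_n(0)=u^0_n$. Then there exist a subsequence (not relabeled) and a bounded measurable $u:[0,T]\to X$ such that 1. $u_n(t)\to u(t)$ for every $t\in[0,T]$; $u_n\rightharpoonup^*u$ in $L^\infty(0,T;X)$; and $u_n\to u$ in $L^p(0,T;X)$ for every $1\le p<\infty$; 2. $u(0)=u_0$ and $u$ is a Dissipative Viscosity solution. -/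

import Mathlib

open Set Filter Topology MeasureTheory
open scoped ENNReal

noncomputable section

variable {X : Type*} [NormedAddCommGroup X] [InnerProductSpace ℝ X] [CompleteSpace X]

/-- The power `∂ₜ 𝓔ₜ(u)`: partial derivative in time, one-sided at the end-points of `[0,T]`. -/
def power (T : ℝ) (E : ℝ → X → ℝ) (t : ℝ) (u : X) : ℝ :=
  derivWithin (fun s => E s u) (Icc 0 T) t

/-- The critical set `𝓒(t) = {u : D𝓔ₜ(u) = 0}`. -/
def criticalSet (E : ℝ → X → ℝ) (t : ℝ) : Set X :=
  {u | gradient (E t) u = 0}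

/-- Smoothness: `𝓔 ∈ C¹([0,T] × X)`. -/
def SmoothEnergy (T : ℝ) (E : ℝ → X → ℝ) : Prop :=
  ContDiffOn ℝ 1 (fun p : ℝ × X => E p.1 p.2) (Icc 0 T ×ˢ univ)

/-- Coercivity: every sublevel of `u ↦ sup_{t ∈ [0,T]} |𝓔ₜ(u)|` is bounded. -/
def Coercive (T : ℝ) (E : ℝ → X → ℝ) : Prop :=
  ∀ ρ : ℝ, 0 < ρ → Bornology.IsBounded {u : X | (⨆ t : Icc (0 : ℝ) T, |E t u|) ≤ ρ}

/-- Power control: `|∂ₜ 𝓔ₜ(u)| ≤ C₁ 𝓔ₜ(u) + C₂`. -/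
def PowerControl (T : ℝ) (E : ℝ → X → ℝ) : Prop :=
  ∃ C₁ C₂ : ℝ, 0 < C₁ ∧ 0 < C₂ ∧ ∀ t ∈ Icc 0 T, ∀ u : X, |power T E t u| ≤ C₁ * E t u + C₂

/-- For every `t ∈ [0,T]` each point of `𝓒(t)` is isolated in `𝓒(t)`. -/
def IsolatedCriticalPoints (T : ℝ) (E : ℝ → X → ℝ) : Prop :=
  ∀ t ∈ Icc 0 T, ∀ u ∈ criticalSet E t, ∃ r > 0, ∀ v ∈ criticalSet E t, dist v u < r → v = u

/-- `u ∈ H¹(0,T;X)` (continuous representative, with weak derivative `v ∈ L²(0,T;X)`) solves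
`ε u' + D𝓔ₜ(u) = 0` for a.e. `t ∈ (0,T)`. -/
def IsGradientFlow (T : ℝ) (E : ℝ → X → ℝ) (ε : ℝ) (u : ℝ → X) : Prop :=
  ∃ v : ℝ → X, MemLp v 2 (volume.restrict (Ioo 0 T)) ∧
    (∀ t ∈ Icc 0 T, u t = u 0 + ∫ r in (0 : ℝ)..t, v r) ∧
    ∀ᵐ t ∂(volume.restrict (Ioo 0 T)), ε • v t + gradient (E t) (u t) = 0

/-- Admissible curves joining `u₁` to `u₂` at time `t`: continuous on `[0,1]`, with a partition
`0 = τ₀ < ⋯ < τⱼ = 1` such that the curve is locally Lipschitz and stays out of `𝓒(t)` on each open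
subinterval, and the intermediate nodes are mapped into `𝓒(t)`. -/
def Admissible (E : ℝ → X → ℝ) (t : ℝ) (u₁ u₂ : X) (θ : ℝ → X) : Prop :=
  ContinuousOn θ (Icc 0 1) ∧ θ 0 = u₁ ∧ θ 1 = u₂ ∧
    ∃ (j : ℕ) (τ : ℕ → ℝ), τ 0 = 0 ∧ τ j = 1 ∧ (∀ i < j, τ i < τ (i + 1)) ∧
      (∀ i < j, LocallyLipschitzOn (Ioo (τ i) (τ (i + 1))) θ) ∧
      (∀ i, 0 < i → i < j → θ (τ i) ∈ criticalSet E t) ∧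
      ∀ i < j, ∀ r ∈ Ioo (τ i) (τ (i + 1)), θ r ∉ criticalSet E t

/-- The energy-dissipation integral `∫₀¹ ‖D𝓔ₜ(θ(s))‖ ‖θ'(s)‖ ds`, with values in `[0,∞]`. -/
def dissipation (E : ℝ → X → ℝ) (t : ℝ) (θ : ℝ → X) : ℝ≥0∞ :=
  ∫⁻ s in Ioo (0 : ℝ) 1, ENNReal.ofReal (‖gradient (E t) (θ s)‖ * ‖deriv θ s‖)

open scoped Classical in
/-- The energy-dissipation cost `𝖼(t;u₁,u₂)`, with values in `[0,∞]` (`inf ∅ = ∞`). -/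
def cost (E : ℝ → X → ℝ) (t : ℝ) (u₁ u₂ : X) : ℝ≥0∞ :=
  if u₁ = u₂ then 0 else ⨅ (θ : ℝ → X) (_ : Admissible E t u₁ u₂ θ), dissipation E t θ

/-- The set of atoms of a measure on the line. -/
def atoms (μ : Measure ℝ) : Set ℝ := {t | μ {t} ≠ 0}

/-- `u : [0,T] → X`, with one-sided limits `um = u₋`, `up = u₊` and defect measure `μ`, is a
Dissipative Viscosity solution. Only the values of `u`, `um`, `up` on `[0,T]` matter. -/
structure IsDissipativeViscosityTriple (T : ℝ) (E : ℝ → X → ℝ) (u um up : ℝ → X)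
    (μ : Measure ℝ) : Prop where
  measurable : StronglyMeasurable (fun t : Icc (0 : ℝ) T => u t)
  bounded : ∃ M : ℝ, ∀ t ∈ Icc 0 T, ‖u t‖ ≤ M
  left_limit : ∀ s ∈ Ioc 0 T, Tendsto u (𝓝[<] s) (𝓝 (um s))
  right_limit : ∀ t ∈ Ico 0 T, Tendsto u (𝓝[>] t) (𝓝 (up t))
  left_zero : um 0 = u 0
  right_end : up T = u T
  finite : IsFiniteMeasure μ
  concentrated : μ (Icc 0 T)ᶜ = 0
  countable_atoms : (atoms μ).Countable
  power_integrable : IntervalIntegrable (fun r => power T E r (u r)) volume 0 T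
  energy_identity : ∀ s t : ℝ, 0 ≤ s → s ≤ t → t ≤ T →
    (μ (Icc s t)).toReal + E t (up t) = E s (um s) + ∫ r in s..t, power T E r (u r)
  continuous_off_atoms : ∀ t ∈ Icc 0 T \ atoms μ, ContinuousWithinAt u (Icc 0 T) t
  critical_off_atoms : ∀ t ∈ Ioc 0 T \ atoms μ, u t ∈ criticalSet E t
  left_critical : ∀ s ∈ Ioc 0 T, um s ∈ criticalSet E s
  right_critical : ∀ t ∈ Ico 0 T, up t ∈ criticalSet E t
  atoms_eq_jumps : atoms μ = {t | t ∈ Icc 0 T ∧ um t ≠ up t}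
  jump_pos : ∀ t ∈ atoms μ, 0 < cost E t (um t) (up t)
  jump_cost : ∀ t ∈ atoms μ, cost E t (um t) (up t) = μ {t}
  jump_energy : ∀ t ∈ atoms μ, (μ {t}).toReal = E t (um t) - E t (up t)

/-- Dissipative Viscosity solutions on `[0,T]` of the limit problem `D𝓔ₜ(u(t)) = 0`. -/
def IsDissipativeViscositySolution (T : ℝ) (E : ℝ → X → ℝ) (u : ℝ → X) : Prop :=
  ∃ (um up : ℝ → X) (μ : Measure ℝ), IsDissipativeViscosityTriple T E u um up μ

/-- Weak-* convergence `f n ⇀* g` in `L^∞(0,T;X)`, the dual of `L¹(0,T;X)`. -/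
def WeakStarTendsto (T : ℝ) (f : ℕ → ℝ → X) (g : ℝ → X) : Prop :=
  (∀ n, MemLp (f n) ∞ (volume.restrict (Ioo 0 T))) ∧ MemLp g ∞ (volume.restrict (Ioo 0 T)) ∧
    ∀ φ : ℝ → X, Integrable φ (volume.restrict (Ioo 0 T)) →
      Tendsto (fun n => ∫ t in Ioo 0 T, inner ℝ (f n t) (φ t)) atTop
        (𝓝 (∫ t in Ioo 0 T, inner ℝ (g t) (φ t)))

/-- Strong convergence `f n → g` in `L^p(0,T;X)`. -/
def LpTendsto (T : ℝ) (p : ℝ≥0∞) (f : ℕ → ℝ → X) (g : ℝ → X) : Prop :=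
  (∀ n, MemLp (f n) p (volume.restrict (Ioo 0 T))) ∧ MemLp g p (volume.restrict (Ioo 0 T)) ∧
    Tendsto (fun n => eLpNorm (f n - g) p (volume.restrict (Ioo 0 T))) atTop (𝓝 0)

end

/-! Along a gradient flow the dissipated energy `V_n(t) = ∫₀ᵗ ε⁻¹‖D𝓔‖²` is nondecreasing and equals
initial energy plus work of the power minus current energy; Gronwall and coercivity bound `u_n` and
`V_n` uniformly. Total variation of `u_n` is not controlled, but where the slope is at least `m`, a
displacement `d` costs dissipation at least `m * d`. Critical points being isolated, a flow that
moves appreciably near time `t` has to travel some distance away from `𝓒(t)`, so it dissipates a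
fixed amount. Small increments of `V_n` therefore force small oscillations of `u_n`
(`exists_oscillation_modulus`), and Helly's argument gives a subsequence converging at every time
(`exists_subseq_tendsto_of_dissipationBound`).

The energy identity passes to the limit: `V_n` converges everywhere to a monotone `V` written
explicitly in terms of the limit `v`. Wherever `V` has one-sided limits, so has `v`; these are
critical because `∫‖D𝓔‖² = ε_n V_n(T) → 0`. The defect measure is the Stieltjes measure of `V`, and
the identity for `V` is the energy balance.

At a jump the atom equals the energy drop, which the chain rule bounds above by the cost
(`ofReal_sub_le_cost`). For the converse (`IsFlowLimit.cost_le`), competitors are built from `u_n`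
on a short interval around `t`. Since `u_n` may meet `𝓒(t)` infinitely often, its excursions into
small balls around critical points are replaced by radial segments of negligible cost
(`joinable_of_avoidance`); outside the balls the slope at the frozen time `t` is at most `1 + η`
times the actual one, so the cost is essentially the increment of `V_n`. -/

/-! ### Compactness of paths of bounded dissipation. -/

section Compactness

variable {X : Type*} [NormedAddCommGroup X]

/-- `V` is a monotone function bounding the dissipation of the path `u` driven by the slope `G`. -/
structure DissipationBound (G : ℝ → X → X) (u : ℝ → X) (V : ℝ → ℝ) : Prop where
  cont : Continuous u
  mono : Monotone V
  le : ∀ a b m : ℝ, a ≤ b → 0 ≤ m → (∀ r ∈ Icc a b, m ≤ ‖G r (u r)‖) →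
    m * ‖u b - u a‖ ≤ V b - V a

/-- Every zero of `g` is an isolated zero. -/
def IsolatedZeros (g : X → X) : Prop :=
  ∀ v, g v = 0 → ∃ r > 0, ∀ w, g w = 0 → dist w v < r → w = v

theorem exists_crossing_up {φ : ℝ → ℝ} (hφ : Continuous φ) {p q α β : ℝ} (hpq : p ≤ q)
    (hαβ : α < β) (hp : φ p ≤ α) (hq : β ≤ φ q) :
    ∃ s₁ s₂, p ≤ s₁ ∧ s₁ ≤ s₂ ∧ s₂ ≤ q ∧ φ s₁ ≤ α ∧ β ≤ φ s₂ ∧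
      ∀ r ∈ Icc s₁ s₂, α ≤ φ r ∧ φ r ≤ β := by
  -- `s₂` is the first time at level `β`, `s₁` the last time before it at level `α`; in between both
  -- bounds hold.
  obtain ⟨s₂, ⟨⟨h1, h2⟩, h3⟩, h4⟩ := (isCompact_Icc (a := p) (b := q)).inter_right
    (isClosed_le continuous_const hφ) |>.exists_isLeast ⟨q, ⟨hpq, le_rfl⟩, hq⟩
  obtain ⟨s₁, ⟨⟨k1, k2⟩, k3⟩, k4⟩ := (isCompact_Icc (a := p) (b := s₂)).inter_right
    (isClosed_le hφ continuous_const) |>.exists_isGreatest ⟨p, ⟨le_rfl, h1⟩, hp⟩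
  simp only [mem_ofPred_eq] at h3 k3
  have hlt : s₁ < s₂ := lt_of_le_of_ne k2 (by rintro rfl; linarith)
  have hIoo : ∀ r ∈ Ioo s₁ s₂, α ≤ φ r ∧ φ r ≤ β := by
    intro r hr
    constructor
    · by_contra! h
      exact absurd (k4 ⟨⟨k1.trans hr.1.le, hr.2.le⟩, h.le⟩) (not_le.2 hr.1)
    · by_contra! h
      exact absurd (h4 ⟨⟨k1.trans hr.1.le, hr.2.le.trans h2⟩, h.le⟩) (not_le.2 hr.2)
  refine ⟨s₁, s₂, k1, k2, h2, k3, h3, fun r hr => ?_⟩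
  have hcl : IsClosed {r | α ≤ φ r ∧ φ r ≤ β} :=
    (isClosed_le continuous_const hφ).inter (isClosed_le hφ continuous_const)
  have := closure_minimal (s := Ioo s₁ s₂) (t := {r | α ≤ φ r ∧ φ r ≤ β}) hIoo hcl
  rw [closure_Ioo hlt.ne] at this
  exact this hr

theorem exists_crossing {φ : ℝ → ℝ} (hφ : Continuous φ) {p q α β : ℝ} (hpq : p ≤ q)
    (hαβ : α < β) (h : (φ p ≤ α ∧ β ≤ φ q) ∨ (β ≤ φ p ∧ φ q ≤ α)) :
    ∃ s₁ s₂, p ≤ s₁ ∧ s₁ ≤ s₂ ∧ s₂ ≤ q ∧ β - α ≤ |φ s₂ - φ s₁| ∧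
      ∀ r ∈ Icc s₁ s₂, α ≤ φ r ∧ φ r ≤ β := by
  rcases h with ⟨h1, h2⟩ | ⟨h1, h2⟩
  · obtain ⟨s₁, s₂, k1, k2, k3, k4, k5, k6⟩ := exists_crossing_up hφ hpq hαβ h1 h2
    exact ⟨s₁, s₂, k1, k2, k3, le_trans (by linarith) (le_abs_self _), k6⟩
  · obtain ⟨s₁, s₂, k1, k2, k3, k4, k5, k6⟩ := exists_crossing_up (φ := fun r => -φ r)
      hφ.neg hpq (neg_lt_neg hαβ) (neg_le_neg h1) (neg_le_neg h2)
    refine ⟨s₁, s₂, k1, k2, k3, le_trans (by linarith) (neg_le_abs _), fun r hr => ?_⟩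
    have := k6 r hr
    constructor <;> linarith [this.1, this.2]

theorem IsolatedZeros.exists_separation {g : X → X} (hi : IsolatedZeros g) {F : Set X}
    (hF : F.Finite) (h0 : ∀ c ∈ F, g c = 0) :
    ∃ ρ > 0, ∀ c ∈ F, ∀ w, g w = 0 → dist w c < ρ → w = c := by
  have : ∀ᶠ ρ in 𝓝[>] (0 : ℝ), ∀ c ∈ F, ∀ w, g w = 0 → dist w c < ρ → w = c := by
    rw [eventually_all_finite hF]
    intro c hc
    obtain ⟨r, hr, h⟩ := hi c (h0 c hc)
    filter_upwards [Ioo_mem_nhdsGT hr] with ρ hρ w hw hd using h w hw (hd.trans hρ.2)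
  obtain ⟨ρ, h1, h2⟩ := (this.and self_mem_nhdsWithin).exists
  exact ⟨ρ, h2, h1⟩

theorem exists_subseq_tendsto_on_countable {Y : Type*} [TopologicalSpace Y]
    [FirstCountableTopology Y] {K : Set Y} (hK : IsCompact K) {S : Set ℝ} (hS : S.Countable)
    (f : ℕ → ℝ → Y) (hf : ∀ n t, f n t ∈ K) :
    ∃ k : ℕ → ℕ, StrictMono k ∧ ∀ t ∈ S, ∃ y, Tendsto (fun n => f (k n) t) atTop (𝓝 y) := by
  have : Countable S := hS.to_subtype
  obtain ⟨y, -, k, hk, hlim⟩ := (isCompact_univ_pi fun _ : S => hK).tendsto_subseq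
    (x := fun n (s : S) => f n s) fun n => fun s _ => hf n s
  exact ⟨k, hk, fun t ht => ⟨y ⟨t, ht⟩, (tendsto_pi_nhds.1 hlim) ⟨t, ht⟩⟩⟩

variable [NormedSpace ℝ X] [FiniteDimensional ℝ X]

theorem IsolatedZeros.finite_inter_closedBall {g : X → X} (hg : Continuous g)
    (hi : IsolatedZeros g) (R : ℝ) : {v | v ∈ Metric.closedBall (0 : X) R ∧ g v = 0}.Finite := by
  have : ProperSpace X := FiniteDimensional.proper_real X
  have hK : IsCompact {v | v ∈ Metric.closedBall (0 : X) R ∧ g v = 0} :=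
    (isCompact_closedBall 0 R).inter_right (isClosed_eq hg continuous_const)
  choose! r hr hr' using hi
  obtain ⟨s, hs, hs'⟩ := hK.elim_nhds_subcover (fun v => Metric.ball v (r v))
    fun v hv => Metric.ball_mem_nhds _ (hr v hv.2)
  refine s.finite_toSet.subset fun v hv => ?_
  obtain ⟨w, hw, hvw⟩ := mem_iUnion₂.1 (hs' hv)
  rw [hr' w (hs w hw).2 v hv.2 hvw]
  exact hw

theorem exists_uniform_time_modulus {G : ℝ → X → X} (hG : Continuous fun p : ℝ × X => G p.1 p.2)
    (R t : ℝ) {ω : ℝ} (hω : 0 < ω) :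
    ∃ δ > 0, ∀ r, |r - t| ≤ δ → ∀ x, ‖x‖ ≤ R → ‖G r x - G t x‖ ≤ ω := by
  have : ProperSpace X := FiniteDimensional.proper_real X
  have hK : IsCompact (Icc (t - 1) (t + 1) ×ˢ Metric.closedBall (0 : X) R) :=
    isCompact_Icc.prod (isCompact_closedBall 0 R)
  obtain ⟨δ, hδ, h⟩ := Metric.uniformContinuousOn_iff.1
    (hK.uniformContinuousOn_of_continuous hG.continuousOn) ω hω
  refine ⟨min 1 (δ / 2), by positivity, fun r hr x hx => ?_⟩
  have h1 := abs_le.1 (hr.trans (min_le_left _ _))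
  have hx' : x ∈ Metric.closedBall (0 : X) R := by simpa using hx
  have := h (r, x) ⟨⟨by linarith [h1.1], by linarith [h1.2]⟩, hx'⟩ (t, x)
    ⟨⟨by linarith, by linarith⟩, hx'⟩ (by
      rw [Prod.dist_eq]
      simp only [dist_self, Real.dist_eq]
      exact max_lt ((hr.trans (min_le_right _ _)).trans_lt (by linarith)) hδ)
  rw [← dist_eq_norm]
  exact this.le

theorem exists_slope_lower_bound {g : X → X} (hg : Continuous g) (R : ℝ) {ρ : ℝ} (hρ : 0 < ρ) :
    ∃ m > 0, ∀ x, ‖x‖ ≤ R → (∀ c, ‖c‖ ≤ R → g c = 0 → ρ ≤ dist x c) → m ≤ ‖g x‖ := by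
  have : ProperSpace X := FiniteDimensional.proper_real X
  have hK : IsCompact (Metric.closedBall (0 : X) R ∩
      {x | ∀ c, ‖c‖ ≤ R → g c = 0 → ρ ≤ dist x c}) := by
    refine (isCompact_closedBall 0 R).inter_right ?_
    simp only [ofPred_forall]
    exact isClosed_iInter fun c => isClosed_iInter fun _ => isClosed_iInter fun _ =>
      isClosed_le continuous_const (continuous_id.dist continuous_const)
  rcases eq_empty_or_nonempty (Metric.closedBall (0 : X) R ∩
      {x | ∀ c, ‖c‖ ≤ R → g c = 0 → ρ ≤ dist x c}) with he | hne
  · refine ⟨1, one_pos, fun x hx hx' => ?_⟩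
    have : x ∈ (∅ : Set X) := he ▸ ⟨by simpa using hx, hx'⟩
    exact this.elim
  · obtain ⟨y, ⟨hy1, hy2⟩, hmin⟩ := hK.exists_isMinOn hne hg.norm.continuousOn
    refine ⟨‖g y‖, norm_pos_iff.2 fun h0 => ?_, fun x hx hx' => hmin ⟨by simpa using hx, hx'⟩⟩
    have := hy2 y (by simpa using hy1) h0
    rw [dist_self] at this
    linarith

/-- A path with small dissipation near time `t` has small oscillation. -/
theorem exists_oscillation_modulus {G : ℝ → X → X} (hG : Continuous fun p : ℝ × X => G p.1 p.2)
    (R t : ℝ) (hi : IsolatedZeros (G t)) {η : ℝ} (hη : 0 < η) :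
    ∃ κ > 0, ∃ δ > 0, ∀ (u : ℝ → X) (V : ℝ → ℝ), DissipationBound G u V → (∀ r, ‖u r‖ ≤ R) →
      ∀ a b, a ≤ b → |a - t| ≤ δ → |b - t| ≤ δ → V b - V a < κ → ‖u b - u a‖ < η := by
  have hGt : Continuous (G t) := hG.comp (by fun_prop : Continuous fun x => (t, x))
  obtain ⟨ρ₀, hρ₀, hsep⟩ := hi.exists_separation (hi.finite_inter_closedBall hGt R)
    fun c hc => hc.2
  -- `ρ ≤ η / 4` keeps both ends of an oscillation of size `η` from lying within `ρ` of one zero; `ρ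
  -- ≤ ρ₀ / 2` keeps a `ρ`-ball around one zero at distance at least `ρ` from the others.
  obtain ⟨ρ, hρ, hρη, hρρ⟩ : ∃ ρ > 0, ρ ≤ η / 4 ∧ ρ ≤ ρ₀ / 2 :=
    ⟨min (η / 4) (ρ₀ / 2), by positivity, min_le_left _ _, min_le_right _ _⟩
  obtain ⟨m, hm, hlow⟩ := exists_slope_lower_bound hGt R (half_pos hρ)
  obtain ⟨δ, hδ, hmod⟩ := exists_uniform_time_modulus hG R t (half_pos hm)
  -- The cost of crossing an annulus `ρ / 2 ≤ dist · c ≤ ρ`: its width times `m / 2`, what is left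
  -- of the slope bound `m` after time variation.
  refine ⟨m / 2 * (ρ / 2), by positivity, δ, hδ, fun u V hD hu a b hab ha hb hV => ?_⟩
  by_contra! hosc
  have hlow' : ∀ r ∈ Icc a b, (∀ c, ‖c‖ ≤ R → G t c = 0 → ρ / 2 ≤ dist (u r) c) →
      m / 2 ≤ ‖G r (u r)‖ := by
    intro r hr hc
    have h1 := hlow (u r) (hu r) hc
    have h2 := hmod r (abs_le.2 ⟨by linarith [(abs_le.1 ha).1, hr.1],
      by linarith [(abs_le.1 hb).2, hr.2]⟩) (u r) (hu r)
    have h3 := norm_sub_norm_le (G t (u r)) (G r (u r))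
    rw [norm_sub_rev] at h3
    linarith
  by_cases hcase : ∀ r ∈ Icc a b, ∀ c, ‖c‖ ≤ R → G t c = 0 → ρ / 2 ≤ dist (u r) c
  · have := hD.le a b (m / 2) hab (by positivity) fun r hr => hlow' r hr (hcase r hr)
    have : m / 2 * (ρ / 2) ≤ m / 2 * ‖u b - u a‖ := by gcongr; linarith
    linarith
  push Not at hcase
  obtain ⟨r₀, hr₀, c, hcR, hc0, hd⟩ := hcase
  have hφ : Continuous fun r => dist (u r) c := hD.cont.dist continuous_const
  have key : ∃ s₁ s₂, a ≤ s₁ ∧ s₁ ≤ s₂ ∧ s₂ ≤ b ∧ ρ - ρ / 2 ≤ |dist (u s₂) c - dist (u s₁) c| ∧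
      ∀ r ∈ Icc s₁ s₂, ρ / 2 ≤ dist (u r) c ∧ dist (u r) c ≤ ρ := by
    have htri : ‖u b - u a‖ ≤ dist (u b) c + dist (u a) c := by
      rw [← dist_eq_norm]; exact dist_triangle_right _ _ _
    by_cases hbc : ρ ≤ dist (u b) c
    · obtain ⟨s₁, s₂, h1, h2, h3, h4, h5⟩ :=
        exists_crossing hφ hr₀.2 (half_lt_self hρ) (Or.inl ⟨hd.le, hbc⟩)
      exact ⟨s₁, s₂, hr₀.1.trans h1, h2, h3, h4, h5⟩
    · obtain ⟨s₁, s₂, h1, h2, h3, h4, h5⟩ :=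
        exists_crossing hφ hr₀.1 (half_lt_self hρ) (Or.inr ⟨by linarith, hd.le⟩)
      exact ⟨s₁, s₂, h1, h2, h3.trans hr₀.2, h4, h5⟩
  obtain ⟨s₁, s₂, h1, h2, h3, h4, h5⟩ := key
  have h6 := hD.le s₁ s₂ (m / 2) h2 (by positivity) fun r hr =>
    hlow' r ⟨h1.trans hr.1, hr.2.trans h3⟩ fun c' hc'R hc'0 => by
      by_cases hcc : c' = c
      · rw [hcc]; exact (h5 r hr).1
      · have h7 : ρ₀ ≤ dist c' c := by
          by_contra! h
          exact hcc (hsep c ⟨by simpa using hcR, hc0⟩ c' hc'0 h)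
        have h8 := dist_triangle_left c' c (u r)
        linarith [(h5 r hr).2]
  have h7 : |dist (u s₂) c - dist (u s₁) c| ≤ ‖u s₂ - u s₁‖ := by
    rw [← dist_eq_norm]; exact abs_dist_sub_le _ _ _
  have h8 : m / 2 * (ρ / 2) ≤ m / 2 * ‖u s₂ - u s₁‖ := by gcongr; linarith
  linarith [hD.mono h1, hD.mono h3]

/-- Helly-type selection for paths of uniformly bounded dissipation. -/
theorem exists_subseq_tendsto_of_dissipationBound {G : ℝ → X → X}
    (hG : Continuous fun p : ℝ × X => G p.1 p.2) (hi : ∀ t, IsolatedZeros (G t))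
    {u : ℕ → ℝ → X} {V : ℕ → ℝ → ℝ} (hD : ∀ n, DissipationBound G (u n) (V n)) {R M : ℝ}
    (hu : ∀ n r, ‖u n r‖ ≤ R) (hV : ∀ n r, |V n r| ≤ M) :
    ∃ (k : ℕ → ℕ) (v : ℝ → X), StrictMono k ∧
      ∀ t, Tendsto (fun n => u (k n) t) atTop (𝓝 (v t)) := by
  have : ProperSpace X := FiniteDimensional.proper_real X
  obtain ⟨k₁, hk₁, hlim₁⟩ := exists_subseq_tendsto_on_countable (K := Icc (-M) M) isCompact_Icc
    (countable_range ((↑) : ℚ → ℝ)) V fun n t => abs_le.1 (hV n t)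
  -- The limsup provides a monotone function on the whole line, so with countably many
  -- discontinuities; it is a true limit at rational times.
  set g : ℝ → ℝ := fun t => limsup (fun n => V (k₁ n) t) atTop with hgdef
  have hgm : Monotone g := fun s t hst =>
    limsup_le_limsup (Eventually.of_forall fun n => (hD (k₁ n)).mono hst)
      (isCoboundedUnder_le_of_le atTop (x := -M) fun n => (abs_le.1 (hV (k₁ n) s)).1)
      (isBoundedUnder_of ⟨M, fun n => (abs_le.1 (hV (k₁ n) t)).2⟩)
  have hgq : ∀ q : ℚ, Tendsto (fun n => V (k₁ n) q) atTop (𝓝 (g q)) := fun q => by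
    obtain ⟨y, hy⟩ := hlim₁ q ⟨q, rfl⟩
    rw [hgdef]; simp only; rw [hy.limsup_eq]; exact hy
  obtain ⟨k₂, hk₂, hlim₂⟩ := exists_subseq_tendsto_on_countable (isCompact_closedBall (0 : X) R)
    ((countable_range ((↑) : ℚ → ℝ)).union hgm.countable_not_continuousAt)
    (fun n => u (k₁ n)) fun n t => by simpa using hu (k₁ n) t
  have hall : ∀ t, ∃ y, Tendsto (fun n => u (k₁ (k₂ n)) t) atTop (𝓝 y) := by
    intro t
    by_cases hc : ContinuousAt g t
    swap
    · exact hlim₂ t (Or.inr hc)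
    -- At a continuity point of `g`, rationals on both sides enclose a small increment of the
    -- dissipations, so `u n t` stays close to its value at `q₁`, where convergence is known.
    refine cauchySeq_tendsto_of_complete (Metric.cauchySeq_iff'.2 fun η hη => ?_)
    obtain ⟨κ, hκ, δ, hδ, hosc⟩ := exists_oscillation_modulus hG R t (hi t) (η := η / 3)
      (by positivity)
    obtain ⟨δ', hδ', hgc⟩ := Metric.continuousAt_iff.1 hc (κ / 2) (by positivity)
    obtain ⟨q₁, hq₁, hq₁'⟩ := exists_rat_btwn (show t - min δ δ' < t by
      have : 0 < min δ δ' := lt_min hδ hδ'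
      linarith)
    obtain ⟨q₂, hq₂, hq₂'⟩ := exists_rat_btwn (show t < t + min δ δ' by
      have : 0 < min δ δ' := lt_min hδ hδ'
      linarith)
    have hm1 := min_le_left δ δ'
    have hm2 := min_le_right δ δ'
    have e1 := abs_lt.1 (hgc (x := (q₁ : ℝ)) (by
      rw [Real.dist_eq, abs_lt]; constructor <;> linarith))
    have e2 := abs_lt.1 (hgc (x := (q₂ : ℝ)) (by
      rw [Real.dist_eq, abs_lt]; constructor <;> linarith))
    have hVlim : Tendsto (fun n => V (k₁ (k₂ n)) q₂ - V (k₁ (k₂ n)) q₁) atTop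
        (𝓝 (g q₂ - g q₁)) := ((hgq q₂).sub (hgq q₁)).comp hk₂.tendsto_atTop
    have hsmall := hVlim.eventually (gt_mem_nhds (show g q₂ - g q₁ < κ by linarith [e1.1, e2.2]))
    obtain ⟨y, hy⟩ := hlim₂ q₁ (Or.inl ⟨q₁, rfl⟩)
    obtain ⟨N₁, hN₁⟩ := Metric.cauchySeq_iff.1 hy.cauchySeq (η / 3) (by positivity)
    obtain ⟨N₂, hN₂⟩ := eventually_atTop.1 hsmall
    have hnear : ∀ n ≥ N₂, dist (u (k₁ (k₂ n)) t) (u (k₁ (k₂ n)) q₁) < η / 3 := fun n hn => by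
      rw [dist_eq_norm]
      refine hosc _ _ (hD _) (hu _) q₁ t hq₁'.le ?_ (by simpa using hδ.le) ?_
      · rw [abs_le]; constructor <;> linarith
      · linarith [hN₂ n hn, (hD (k₁ (k₂ n))).mono hq₂.le]
    refine ⟨max N₁ N₂, fun n hn => ?_⟩
    have a1 := hnear n ((le_max_right _ _).trans hn)
    have a2 := hnear (max N₁ N₂) (le_max_right _ _)
    have a3 := hN₁ n ((le_max_left _ _).trans hn) (max N₁ N₂) (le_max_left _ _)
    have a4 := dist_triangle4 (u (k₁ (k₂ n)) t) (u (k₁ (k₂ n)) q₁)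
      (u (k₁ (k₂ (max N₁ N₂))) q₁) (u (k₁ (k₂ (max N₁ N₂))) t)
    rw [dist_comm (u (k₁ (k₂ (max N₁ N₂))) q₁)] at a4
    linarith
  choose v hv using hall
  exact ⟨k₁ ∘ k₂, v, hk₁.comp hk₂, hv⟩

end Compactness

/-! ### Building competitors with finitely many critical points. -/

section Joining

variable {X : Type*} [NormedAddCommGroup X] [NormedSpace ℝ X]

/-- `x` and `y` are joined by a Lipschitz path that meets the zeros of `g` finitely often and along
which the integral of `‖g‖` is at most `D`. -/
def Joinable (g : X → X) (x y : X) (D : ℝ≥0∞) : Prop :=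
  ∃ (ℓ : ℝ) (K : NNReal) (θ : ℝ → X), 0 ≤ ℓ ∧ LipschitzWith K θ ∧ θ 0 = x ∧ θ ℓ = y ∧
    {s | s ∈ Icc 0 ℓ ∧ g (θ s) = 0}.Finite ∧
    ∫⁻ s in Ioo 0 ℓ, ENNReal.ofReal (‖g (θ s)‖ * ‖deriv θ s‖) ≤ D

theorem Joinable.mono {g : X → X} {x y : X} {D D' : ℝ≥0∞} (h : Joinable g x y D) (hD : D ≤ D') :
    Joinable g x y D' := by
  obtain ⟨ℓ, K, θ, h1, h2, h3, h4, h5, h6⟩ := h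
  exact ⟨ℓ, K, θ, h1, h2, h3, h4, h5, h6.trans hD⟩

theorem Joinable.refl (g : X → X) (x : X) (D : ℝ≥0∞) : Joinable g x x D :=
  ⟨0, 0, fun _ => x, le_rfl, LipschitzWith.const x, rfl, rfl,
    (finite_singleton 0).subset fun s hs => by simpa using hs.1, by simp⟩

theorem setLIntegral_Ioo_add_right (F : ℝ → ℝ≥0∞) (a b c : ℝ) :
    ∫⁻ s in Ioo (a + c) (b + c), F s = ∫⁻ s in Ioo a b, F (s + c) := by
  have := lintegral_image_eq_lintegral_abs_deriv_mul (s := Ioo a b) (f := fun s => s + c)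
    (f' := fun _ => 1) measurableSet_Ioo
    (fun x _ => ((hasDerivAt_id x).add_const c).hasDerivWithinAt)
    (add_left_injective c).injOn F
  simpa using this

theorem setLIntegral_Ioo_split (F : ℝ → ℝ≥0∞) {a b c : ℝ} (hab : a ≤ b) (hbc : b ≤ c) :
    ∫⁻ s in Ioo a c, F s = (∫⁻ s in Ioo a b, F s) + ∫⁻ s in Ioo b c, F s := by
  simp only [restrict_Ioo_eq_restrict_Ioc]
  rw [← Ioc_union_Ioc_eq_Ioc hab hbc,
    lintegral_union measurableSet_Ioc (Ioc_disjoint_Ioc_of_le le_rfl)]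

theorem Joinable.trans {g : X → X} {x y z : X} {D D' : ℝ≥0∞} (h : Joinable g x y D)
    (h' : Joinable g y z D') : Joinable g x z (D + D') := by
  obtain ⟨ℓ₁, K₁, θ₁, h1, h2, h3, h4, h5, h6⟩ := h
  obtain ⟨ℓ₂, K₂, θ₂, k1, k2, k3, k4, k5, k6⟩ := h'
  -- A single formula instead of a case split: Lipschitz continuity follows by composition and sum.
  -- The free length `ℓ` in `Joinable` spares any rescaling.
  set θ : ℝ → X := fun s => θ₁ (min s ℓ₁) + (θ₂ (max (s - ℓ₁) 0) - y) with hθ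
  have hleft : ∀ s ≤ ℓ₁, θ s = θ₁ s := fun s hs => by
    simp [hθ, min_eq_left hs, max_eq_right (sub_nonpos.2 hs), k3]
  have hright : ∀ s ≥ ℓ₁, θ s = θ₂ (s - ℓ₁) := fun s hs => by
    simp [hθ, min_eq_right hs, max_eq_left (sub_nonneg.2 hs), h4]
  refine ⟨ℓ₁ + ℓ₂, _, θ, by positivity,
    (h2.comp (LipschitzWith.id.min_const ℓ₁)).add
      ((k2.comp ((LipschitzWith.id.sub (LipschitzWith.const ℓ₁)).max_const 0)).sub
        (LipschitzWith.const y)), by rw [hleft 0 h1, h3], ?_, ?_, ?_⟩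
  · rw [hright _ (by linarith), add_sub_cancel_left, k4]
  · refine (h5.union (k5.image (fun s => s + ℓ₁))).subset fun s hs => ?_
    rcases le_total s ℓ₁ with hs1 | hs1
    · exact Or.inl ⟨⟨hs.1.1, hs1⟩, by rw [← hleft s hs1]; exact hs.2⟩
    · exact Or.inr ⟨s - ℓ₁, ⟨⟨by linarith, by linarith [hs.1.2]⟩,
        by rw [← hright s hs1]; exact hs.2⟩, by simp⟩
  · rw [setLIntegral_Ioo_split _ h1 (by linarith : ℓ₁ ≤ ℓ₁ + ℓ₂)]
    refine add_le_add (le_trans (le_of_eq ?_) h6) (le_trans (le_of_eq ?_) k6)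
    · refine setLIntegral_congr_fun measurableSet_Ioo fun s hs => ?_
      have he : θ =ᶠ[𝓝 s] θ₁ := by
        filter_upwards [Iio_mem_nhds hs.2] with r hr using hleft r (le_of_lt hr)
      simp only [he.deriv_eq, he.eq_of_nhds]
    · have := setLIntegral_Ioo_add_right
        (fun s => ENNReal.ofReal (‖g (θ s)‖ * ‖deriv θ s‖)) 0 ℓ₂ ℓ₁
      rw [zero_add, add_comm ℓ₂] at this
      rw [this]
      refine setLIntegral_congr_fun measurableSet_Ioo fun s hs => ?_
      have he : θ =ᶠ[𝓝 (s + ℓ₁)] fun r => θ₂ (r - ℓ₁) := by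
        filter_upwards [Ioi_mem_nhds (by linarith [hs.1] : ℓ₁ < s + ℓ₁)] with r hr
          using hright r (le_of_lt hr)
      simp only [he.deriv_eq, he.eq_of_nhds, deriv_comp_sub_const, add_sub_cancel_right]

theorem joinable_of_lipschitz {g : X → X} {K : NNReal} {γ : ℝ → X} (hγ : LipschitzWith K γ)
    {a b : ℝ} (hab : a ≤ b) (hfin : {s | s ∈ Icc a b ∧ g (γ s) = 0}.Finite) :
    Joinable g (γ a) (γ b) (∫⁻ s in Ioo a b, ENNReal.ofReal (‖g (γ s)‖ * ‖deriv γ s‖)) := by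
  refine ⟨b - a, _, fun s => γ (s + a), by linarith,
    hγ.comp (LipschitzWith.id.add (LipschitzWith.const a)), by simp, by simp, ?_, le_of_eq ?_⟩
  · refine (hfin.image fun s => s - a).subset fun s hs => ⟨s + a, ⟨⟨?_, ?_⟩, hs.2⟩, by simp⟩
    · linarith [hs.1.1]
    · linarith [hs.1.2]
  · have := setLIntegral_Ioo_add_right
      (fun s => ENNReal.ofReal (‖g (γ s)‖ * ‖deriv γ s‖)) 0 (b - a) a
    rw [zero_add, sub_add_cancel] at this
    rw [this]
    simp only [deriv_comp_add_const]

theorem joinable_of_segment {g : X → X} {x y : X} {M : ℝ}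
    (h : ∀ z ∈ segment ℝ x y, ‖g z‖ ≤ M ∧ (g z = 0 → z = x ∨ z = y)) :
    Joinable g x y (ENNReal.ofReal (M * ‖y - x‖)) := by
  by_cases hxy : x = y
  · subst hxy; exact Joinable.refl _ _ _
  have hseg : ∀ s ∈ Icc (0 : ℝ) 1, AffineMap.lineMap x y s ∈ segment ℝ x y := fun s hs => by
    rw [segment_eq_image_lineMap]; exact mem_image_of_mem _ hs
  have := joinable_of_lipschitz (g := g) (lipschitzWith_lineMap (𝕜 := ℝ) x y) zero_le_one
    ((toFinite ({0, 1} : Set ℝ)).subset fun s hs => by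
      rcases (h _ (hseg s hs.1)).2 hs.2 with h' | h'
      · rw [AffineMap.lineMap_eq_left_iff] at h'
        simp [h'.resolve_left hxy]
      · rw [AffineMap.lineMap_eq_right_iff] at h'
        simp [h'.resolve_left hxy])
  simp only [AffineMap.lineMap_apply_zero, AffineMap.lineMap_apply_one] at this
  refine this.mono ?_
  calc ∫⁻ s in Ioo (0 : ℝ) 1, ENNReal.ofReal
        (‖g (AffineMap.lineMap x y s)‖ * ‖deriv (AffineMap.lineMap x y : ℝ → X) s‖)
      ≤ ∫⁻ _ in Ioo (0 : ℝ) 1, ENNReal.ofReal (M * ‖y - x‖) := by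
        refine setLIntegral_mono measurable_const fun s hs => ENNReal.ofReal_le_ofReal ?_
        rw [AffineMap.hasDerivAt_lineMap.deriv]
        gcongr
        exact (h _ (hseg s (Ioo_subset_Icc_self hs))).1
    _ = ENNReal.ofReal (M * ‖y - x‖) := by simp

theorem dist_le_of_mem_segment_left {c x z : X} (hz : z ∈ segment ℝ c x) : dist z c ≤ ‖x - c‖ := by
  rw [segment_eq_image_lineMap] at hz
  obtain ⟨s, hs, rfl⟩ := hz
  rw [dist_lineMap_left, Real.norm_of_nonneg hs.1, dist_comm, dist_eq_norm]
  exact mul_le_of_le_one_left (norm_nonneg _) hs.2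

theorem joinable_center {g : X → X} {c x : X} {M r : ℝ}
    (hsep : ∀ w, g w = 0 → dist w c < r → w = c) (hx : ‖x - c‖ < r)
    (hM : ∀ z, dist z c ≤ ‖x - c‖ → ‖g z‖ ≤ M) :
    Joinable g c x (ENNReal.ofReal (M * ‖x - c‖)) :=
  joinable_of_segment fun z hz =>
    have hz' := dist_le_of_mem_segment_left hz
    ⟨hM z hz', fun h0 => Or.inl (hsep z h0 (hz'.trans_lt hx))⟩

theorem joinable_center' {g : X → X} {c x : X} {M r : ℝ}
    (hsep : ∀ w, g w = 0 → dist w c < r → w = c) (hx : ‖x - c‖ < r)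
    (hM : ∀ z, dist z c ≤ ‖x - c‖ → ‖g z‖ ≤ M) :
    Joinable g x c (ENNReal.ofReal (M * ‖x - c‖)) := by
  rw [norm_sub_rev]
  refine joinable_of_segment fun z hz => ?_
  have hz' := dist_le_of_mem_segment_left (segment_symm ℝ x c ▸ hz)
  exact ⟨hM z hz', fun h0 => Or.inr (hsep z h0 (hz'.trans_lt hx))⟩

/-- A short segment issuing from `x` meets no zero except possibly `x`, and costs at most a local
bound of `‖g‖` times its length. It attaches the one-sided limits at a jump to nearby points of the
flows. -/
theorem IsolatedZeros.exists_joinable_near {g : X → X} (hg : Continuous g) (hi : IsolatedZeros g)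
    (x : X) {η : ℝ} (hη : 0 < η) :
    ∃ σ > 0, ∀ y, dist y x < σ →
      Joinable g x y (ENNReal.ofReal η) ∧ Joinable g y x (ENNReal.ofReal η) := by
  obtain ⟨r, hr, hsep⟩ : ∃ r > 0, ∀ w, g w = 0 → dist w x < r → w = x := by
    by_cases h0 : g x = 0
    · exact hi x h0
    · obtain ⟨r, hr, h⟩ := Metric.eventually_nhds_iff.1 (hg.continuousAt.eventually_ne h0)
      exact ⟨r, hr, fun w hw hwx => absurd hw (h hwx)⟩
  obtain ⟨s, hs, hbd⟩ := Metric.eventually_nhds_iff.1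
    (hg.norm.continuousAt.eventually (gt_mem_nhds (lt_add_one ‖g x‖)))
  refine ⟨min (min r s) (η / (‖g x‖ + 1)), by positivity, fun y hy => ?_⟩
  rw [dist_eq_norm] at hy
  have h1 : ‖y - x‖ < r := hy.trans_le ((min_le_left _ _).trans (min_le_left _ _))
  have h2 : ‖y - x‖ < s := hy.trans_le ((min_le_left _ _).trans (min_le_right _ _))
  have h3 := hy.trans_le (min_le_right _ _)
  rw [lt_div_iff₀ (by positivity)] at h3
  have hM : ∀ z, dist z x ≤ ‖y - x‖ → ‖g z‖ ≤ ‖g x‖ + 1 := fun z hz =>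
    (hbd (hz.trans_lt h2)).le
  have h4 : (‖g x‖ + 1) * ‖y - x‖ ≤ η := by linarith
  exact ⟨(joinable_center hsep h1 hM).mono (ENNReal.ofReal_le_ofReal h4),
    (joinable_center' hsep h1 hM).mono (ENNReal.ofReal_le_ofReal h4)⟩

/-- Replacing the excursions of a Lipschitz path into the balls of radius `ρ` around the zeros of
`g` by pairs of radial segments. -/
theorem joinable_of_avoidance {g : X → X} {K : NNReal} {γ : ℝ → X} (hγ : LipschitzWith K γ)
    {F : Finset X} {ρ r M : ℝ} (hρ : 0 < ρ) (hρr : ρ < r) (hM0 : 0 ≤ M)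
    (hM : ∀ c ∈ F, ∀ z, dist z c ≤ ρ → ‖g z‖ ≤ M)
    (hsep : ∀ c ∈ F, ∀ w, g w = 0 → dist w c < r → w = c) {w : ℝ → ℝ} (hw : Monotone w)
    {a₀ b₀ : ℝ} (hzero : ∀ s ∈ Icc a₀ b₀, g (γ s) = 0 → γ s ∈ F)
    (hpiece : ∀ a b, a₀ ≤ a → a ≤ b → b ≤ b₀ → (∀ s ∈ Ioo a b, ∀ c ∈ F, ρ ≤ dist (γ s) c) →
      ∫⁻ s in Ioo a b, ENNReal.ofReal (‖g (γ s)‖ * ‖deriv γ s‖) ≤ ENNReal.ofReal (w b - w a))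
    (S : Finset X) : ∀ a b, a₀ ≤ a → a ≤ b → b ≤ b₀ →
      (∀ s ∈ Ioo a b, ∀ c ∈ F, c ∉ S → ρ ≤ dist (γ s) c) →
      Joinable g (γ a) (γ b)
        (ENNReal.ofReal (w b - w a + (2 ^ S.card - 1) * (2 * M * ρ))) := by
  classical
  induction S using Finset.induction_on with
  | empty =>
    intro a b ha hab hb hav
    have hav' : ∀ s ∈ Ioo a b, ∀ c ∈ F, ρ ≤ dist (γ s) c := fun s hs c hc =>
      hav s hs c hc (Finset.notMem_empty c)
    refine (joinable_of_lipschitz hγ hab ?_).mono ((hpiece a b ha hab hb hav').trans (by simp))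
    -- Every zero met lies in `F`, whereas interior points keep distance `ρ` from `F`; only the
    -- end-points remain.
    refine (toFinite ({a, b} : Set ℝ)).subset fun s hs => ?_
    by_contra hne
    simp only [mem_insert_iff, mem_singleton_iff, not_or] at hne
    have hs' : s ∈ Ioo a b :=
      ⟨lt_of_le_of_ne hs.1.1 (Ne.symm hne.1), lt_of_le_of_ne hs.1.2 hne.2⟩
    have := hav' s hs' (γ s) (hzero s ⟨ha.trans hs.1.1, hs.1.2.trans hb⟩ hs.2)
    rw [dist_self] at this
    linarith
  | insert c S hcS ih =>
    intro a b ha hab hb hav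
    have hpow : (0 : ℝ) ≤ (2 ^ S.card - 1) * (2 * M * ρ) := by
      have : (1 : ℝ) ≤ 2 ^ S.card := one_le_pow₀ one_le_two
      have : (0 : ℝ) ≤ 2 ^ S.card - 1 := by linarith
      positivity
    have hκ : 0 ≤ 2 * M * ρ := by positivity
    rw [Finset.card_insert_of_notMem hcS]
    by_cases hcF : c ∈ F
    swap
    · refine (ih a b ha hab hb fun s hs c' hc' hc'S => hav s hs c' hc' ?_).mono
        (ENNReal.ofReal_le_ofReal ?_)
      · rw [Finset.mem_insert, not_or]
        exact ⟨fun h => hcF (h ▸ hc'), hc'S⟩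
      · rw [pow_succ]; nlinarith
    by_cases hZ : ∃ s ∈ Icc a b, dist (γ s) c ≤ ρ
    swap
    · push Not at hZ
      refine (ih a b ha hab hb fun s hs c' hc' hc'S => ?_).mono (ENNReal.ofReal_le_ofReal ?_)
      · by_cases h : c' = c
        · rw [h]; exact (hZ s (Ioo_subset_Icc_self hs)).le
        · exact hav s hs c' hc' (by simp [h, hc'S])
      · rw [pow_succ]; nlinarith
    obtain ⟨s₀, hs₀, hs₀'⟩ := hZ
    have hK : IsCompact (Icc a b ∩ {s | dist (γ s) c ≤ ρ}) :=
      isCompact_Icc.inter_right (isClosed_le (hγ.continuous.dist continuous_const) continuous_const)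
    -- First and last visits to the ball around `c`. The outer pieces avoid that ball and are
    -- handled by induction; everything in between is replaced by two radii through `c`.
    obtain ⟨s₁, ⟨h1, h1'⟩, hmin⟩ := hK.exists_isLeast ⟨s₀, hs₀, hs₀'⟩
    obtain ⟨s₂, ⟨h2, h2'⟩, hmax⟩ := hK.exists_isGreatest ⟨s₀, hs₀, hs₀'⟩
    have h12 : s₁ ≤ s₂ := (hmin ⟨hs₀, hs₀'⟩).trans (hmax ⟨hs₀, hs₀'⟩)
    have j1 := ih a s₁ ha h1.1 (h1.2.trans hb) fun s hs c' hc' hc'S => by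
      by_cases h : c' = c
      · rw [h]; by_contra! hlt
        exact absurd (hmin ⟨⟨hs.1.le, hs.2.le.trans h1.2⟩, hlt.le⟩) (not_le.2 hs.2)
      · exact hav s ⟨hs.1, hs.2.trans_le h1.2⟩ c' hc' (by simp [h, hc'S])
    have j2 := ih s₂ b (ha.trans h2.1) h2.2 hb fun s hs c' hc' hc'S => by
      by_cases h : c' = c
      · rw [h]; by_contra! hlt
        exact absurd (hmax ⟨⟨h2.1.trans hs.1.le, hs.2.le⟩, hlt.le⟩) (not_le.2 hs.1)
      · exact hav s ⟨h2.1.trans_lt hs.1, hs.2⟩ c' hc' (by simp [h, hc'S])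
    simp only [mem_ofPred_eq, dist_eq_norm] at h1' h2'
    have k1 : Joinable g (γ s₁) c (ENNReal.ofReal (M * ρ)) :=
      (joinable_center' (hsep c hcF) (h1'.trans_lt hρr) fun z hz =>
        hM c hcF z (hz.trans h1')).mono (ENNReal.ofReal_le_ofReal (by gcongr))
    have k2 : Joinable g c (γ s₂) (ENNReal.ofReal (M * ρ)) :=
      (joinable_center (hsep c hcF) (h2'.trans_lt hρr) fun z hz =>
        hM c hcF z (hz.trans h2')).mono (ENNReal.ofReal_le_ofReal (by gcongr))
    refine (((j1.trans k1).trans k2).trans j2).mono ?_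
    have w1 := hw h1.1
    have w2 := hw h2.2
    have w3 := hw h12
    have hMρ : 0 ≤ M * ρ := by positivity
    rw [← ENNReal.ofReal_add (by linarith) hMρ, ← ENNReal.ofReal_add (by linarith) hMρ,
      ← ENNReal.ofReal_add (by linarith) (by linarith)]
    refine ENNReal.ofReal_le_ofReal ?_
    -- Two recursive pieces and one pair of radii: `2 * (2 ^ k - 1) + 1 = 2 ^ (k + 1) - 1`. The
    -- increment of `w` over the removed piece is nonnegative and is dropped.
    rw [pow_succ]
    nlinarith

theorem exists_partition_of_finite {S : Set ℝ} (hS : S.Finite) (h01 : S ⊆ Icc 0 1) :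
    ∃ (j : ℕ) (τ : ℕ → ℝ), τ 0 = 0 ∧ τ j = 1 ∧ (∀ i < j, τ i < τ (i + 1)) ∧
      (∀ i, 0 < i → i < j → τ i ∈ S) ∧ ∀ i < j, ∀ r ∈ Ioo (τ i) (τ (i + 1)), r ∉ S := by
  classical
  set P : Finset ℝ := insert 0 (insert 1 hS.toFinset) with hP
  have hsub : ∀ x ∈ P, 0 ≤ x ∧ x ≤ 1 := by
    intro x hx
    simp only [hP, Finset.mem_insert, Finite.mem_toFinset] at hx
    rcases hx with rfl | rfl | hx
    · simp
    · simp
    · exact h01 hx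
  have h0P : (0 : ℝ) ∈ P := by simp [hP]
  have h1P : (1 : ℝ) ∈ P := by simp [hP]
  obtain ⟨j, hj⟩ : ∃ j, P.card = j + 1 :=
    Nat.exists_eq_succ_of_ne_zero (Finset.card_pos.2 ⟨0, h0P⟩).ne'
  set e := P.orderEmbOfFin hj
  have hsurj : ∀ x ∈ P, ∃ i, e i = x := fun x hx => by
    have : x ∈ range e := by rw [Finset.range_orderEmbOfFin]; exact hx
    exact this
  have he0 : e 0 = 0 := by
    obtain ⟨i, hi⟩ := hsurj 0 h0P
    exact le_antisymm (hi ▸ e.monotone (Fin.zero_le i)) (hsub _ (P.orderEmbOfFin_mem hj 0)).1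
  have he1 : e (Fin.last j) = 1 := by
    obtain ⟨i, hi⟩ := hsurj 1 h1P
    exact le_antisymm (hsub _ (P.orderEmbOfFin_mem hj _)).2 (hi ▸ e.monotone (Fin.le_last i))
  have hlt : ∀ i < j, i < j + 1 := fun i hi => by omega
  have hlt' : ∀ i < j, i + 1 < j + 1 := fun i hi => by omega
  refine ⟨j, fun i => if h : i < j + 1 then e ⟨i, h⟩ else 0, ?_, ?_, ?_, ?_, ?_⟩
  · simpa using he0
  · simpa [Fin.last] using he1
  · intro i hi
    simp only [hlt i hi, hlt' i hi, dif_pos]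
    exact e.strictMono (Fin.mk_lt_mk.2 (Nat.lt_succ_self i))
  · intro i h0i hij
    simp only [hlt i hij, dif_pos]
    have hm := P.orderEmbOfFin_mem hj ⟨i, hlt i hij⟩
    have a1 : e ⟨i, hlt i hij⟩ ≠ 0 := fun h => by
      rw [← he0] at h
      have := congrArg Fin.val (e.injective h)
      simp at this; omega
    have a2 : e ⟨i, hlt i hij⟩ ≠ 1 := fun h => by
      rw [← he1] at h
      have := congrArg Fin.val (e.injective h)
      simp at this; omega
    simp only [hP, Finset.mem_insert, Finite.mem_toFinset] at hm
    exact (hm.resolve_left a1).resolve_left a2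
  · intro i hi r hr hrS
    simp only [hlt i hi, hlt' i hi, dif_pos] at hr
    obtain ⟨k, rfl⟩ := hsurj r (by simp [hP, hrS])
    have b1 := Fin.lt_def.1 (e.lt_iff_lt.1 hr.1)
    have b2 := Fin.lt_def.1 (e.lt_iff_lt.1 hr.2)
    simp only at b1 b2
    omega

end Joining

/-! ### Comparison of the cost with joining paths and with energy drops. -/

section Cost

variable {X : Type*} [NormedAddCommGroup X] [InnerProductSpace ℝ X] [CompleteSpace X]

/-- The dissipation integral is invariant under the linear rescaling of `[0,ℓ]` to `[0,1]`, and the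
finite set of critical times yields the partition. -/
theorem cost_le_of_joinable {E : ℝ → X → ℝ} {t : ℝ} {x y : X} {D : ℝ≥0∞}
    (h : Joinable (gradient (E t)) x y D) : cost E t x y ≤ D := by
  by_cases hxy : x = y
  · simp [cost, hxy]
  obtain ⟨ℓ, K, θ, h1, h2, h3, h4, h5, h6⟩ := h
  have hℓ : 0 < ℓ := lt_of_le_of_ne h1 fun h0 => hxy (by rw [← h3, ← h4, h0])
  rw [cost, if_neg hxy]
  have hlip : LipschitzWith (K * ‖ℓ‖₊) fun s => θ (ℓ * s) :=
    h2.comp (lipschitzWith_smul (α := ℝ) (β := ℝ) ℓ)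
  refine iInf₂_le_of_le (fun s => θ (ℓ * s)) ⟨hlip.continuous.continuousOn, by simp [h3],
    by simp [h4], ?_⟩ (le_trans (le_of_eq ?_) h6)
  · have hfin : {s | s ∈ Icc (0 : ℝ) 1 ∧ gradient (E t) (θ (ℓ * s)) = 0}.Finite := by
      refine (h5.image fun s => s / ℓ).subset fun s hs => ⟨ℓ * s, ⟨⟨?_, ?_⟩, hs.2⟩, ?_⟩
      · exact mul_nonneg h1 hs.1.1
      · exact mul_le_of_le_one_right h1 hs.1.2
      · field_simp
    obtain ⟨j, τ, t1, t2, t3, t4, t5⟩ := exists_partition_of_finite hfin fun s hs => hs.1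
    refine ⟨j, τ, t1, t2, t3, fun i _ => hlip.locallyLipschitz.locallyLipschitzOn,
      fun i h0 hi => (t4 i h0 hi).2, fun i hi r hr hc => t5 i hi r hr ⟨?_, hc⟩⟩
    have hmono : MonotoneOn τ (Iic j) := by
      refine monotoneOn_of_le_add_one ordConnected_Iic fun a _ _ ha' => (t3 a ?_).le
      exact Nat.lt_of_succ_le ha'
    constructor
    · rw [← t1]
      exact (hmono (Nat.zero_le j) hi.le (Nat.zero_le i)).trans hr.1.le
    · rw [← t2]
      exact hr.2.le.trans (hmono (Nat.succ_le_of_lt hi) (mem_Iic.2 le_rfl) (Nat.succ_le_of_lt hi))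
  · have himg : (fun s => ℓ * s) '' Ioo 0 1 = Ioo 0 ℓ := by
      rw [image_mul_left_Ioo hℓ]; simp
    have := lintegral_image_eq_lintegral_abs_deriv_mul (s := Ioo (0 : ℝ) 1)
      (f := fun s => ℓ * s) (f' := fun _ => ℓ) measurableSet_Ioo
      (fun x _ => by simpa using ((hasDerivAt_id x).const_mul ℓ).hasDerivWithinAt)
      (mul_right_injective₀ hℓ.ne').injOn
      (fun s => ENNReal.ofReal (‖gradient (E t) (θ s)‖ * ‖deriv θ s‖))
    rw [himg] at this
    rw [this, dissipation]
    refine setLIntegral_congr_fun measurableSet_Ioo fun s _ => ?_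
    rw [← ENNReal.ofReal_mul (abs_nonneg _), deriv_comp_mul_left, norm_smul, Real.norm_eq_abs]
    congr 1
    ring

variable [FiniteDimensional ℝ X]

/-- `e ∘ θ` is Lipschitz, hence absolutely continuous; integrate the chain rule and apply
Cauchy–Schwarz. -/
theorem ofReal_sub_le_lintegral_of_lipschitzOn {e : X → ℝ} (he : ContDiff ℝ 1 e) {θ : ℝ → X}
    {K : NNReal} {a b : ℝ} (hab : a ≤ b) (hθ : LipschitzOnWith K θ (Icc a b)) :
    ENNReal.ofReal (e (θ a) - e (θ b)) ≤
      ∫⁻ s in Ioo a b, ENNReal.ofReal (‖gradient e (θ s)‖ * ‖deriv θ s‖) := by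
  obtain ⟨K', hK'⟩ := he.locallyLipschitz.locallyLipschitzOn (s := θ '' Icc a b)
    |>.exists_lipschitzOnWith_of_compact (isCompact_Icc.image_of_continuousOn hθ.continuousOn)
  have hcomp : LipschitzOnWith (K' * K) (e ∘ θ) (Icc a b) := hK'.comp hθ (mapsTo_image _ _)
  rw [← uIcc_of_le hab] at hcomp
  have hac := hcomp.absolutelyContinuousOnInterval
  have hftc := hac.integral_deriv_eq_sub
  have hae : ∀ᵐ s ∂(volume.restrict (Ioo a b)),
      ENNReal.ofReal (-deriv (e ∘ θ) s) ≤
        ENNReal.ofReal (‖gradient e (θ s)‖ * ‖deriv θ s‖) := by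
    have hd := (ae_restrict_iff' measurableSet_Ioo).2
      ((hθ.mono Ioo_subset_Icc_self).ae_differentiableWithinAt_of_mem (μ := volume))
    filter_upwards [hd, ae_restrict_mem measurableSet_Ioo] with s hs hsm
    refine ENNReal.ofReal_le_ofReal ?_
    have hs' := (hs.differentiableAt (Ioo_mem_nhds hsm.1 hsm.2)).hasDerivAt
    have hg : HasGradientAt e (gradient e (θ s)) (θ s) :=
      (he.differentiable one_ne_zero _).hasGradientAt
    have hc := hg.hasFDerivAt.comp_hasDerivAt s hs'
    rw [hc.deriv]
    refine (neg_le_abs _).trans ?_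
    simpa using abs_real_inner_le_norm (gradient e (θ s)) (deriv θ s)
  have hint : IntegrableOn (fun s => -deriv (e ∘ θ) s) (Ioo a b) :=
    ((intervalIntegrable_iff_integrableOn_Ioo_of_le hab).1 hac.intervalIntegrable_deriv).neg
  calc ENNReal.ofReal (e (θ a) - e (θ b))
      = ENNReal.ofReal (∫ s in Ioo a b, -deriv (e ∘ θ) s) := by
        rw [integral_neg, ← integral_Ioc_eq_integral_Ioo, ← intervalIntegral.integral_of_le hab,
          hftc]
        simp
    _ ≤ ∫⁻ s in Ioo a b, ENNReal.ofReal (-deriv (e ∘ θ) s) := by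
        rw [integral_eq_lintegral_pos_part_sub_lintegral_neg_part hint]
        refine (ENNReal.ofReal_le_ofReal (sub_le_self _ ENNReal.toReal_nonneg)).trans
          ENNReal.ofReal_toReal_le
    _ ≤ _ := lintegral_mono_ae hae

/-- Admissible curves are Lipschitz only on compact subintervals of each open piece, so the estimate
is taken on `[c,d]` and extended by continuity as `c → a`, `d → b`. -/
theorem ofReal_sub_le_lintegral {e : X → ℝ} (he : ContDiff ℝ 1 e) {θ : ℝ → X} {a b : ℝ}
    (hab : a < b) (hc : ContinuousOn θ (Icc a b)) (hθ : LocallyLipschitzOn (Ioo a b) θ) :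
    ENNReal.ofReal (e (θ a) - e (θ b)) ≤
      ∫⁻ s in Ioo a b, ENNReal.ofReal (‖gradient e (θ s)‖ * ‖deriv θ s‖) := by
  have hcont : ContinuousOn (fun s => e (θ s)) (Icc a b) :=
    he.continuous.comp_continuousOn hc
  have hinner : ∀ c d, a < c → c ≤ d → d < b → ENNReal.ofReal (e (θ c) - e (θ d)) ≤
      ∫⁻ s in Ioo a b, ENNReal.ofReal (‖gradient e (θ s)‖ * ‖deriv θ s‖) := by
    intro c d hac hcd hdb
    obtain ⟨K, hK⟩ := (hθ.mono (Icc_subset_Ioo hac hdb)).exists_lipschitzOnWith_of_compact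
      isCompact_Icc
    exact (ofReal_sub_le_lintegral_of_lipschitzOn he hcd hK).trans
      (lintegral_mono_set (Ioo_subset_Ioo hac.le hdb.le))
  have hleft : Tendsto (fun s => e (θ s)) (𝓝[>] a) (𝓝 (e (θ a))) :=
    (hcont a ⟨le_rfl, hab.le⟩).mono_left (by
      rw [← nhdsWithin_Ioo_eq_nhdsGT hab]; exact nhdsWithin_mono _ Ioo_subset_Icc_self)
  have hright : Tendsto (fun s => e (θ s)) (𝓝[<] b) (𝓝 (e (θ b))) :=
    (hcont b ⟨hab.le, le_rfl⟩).mono_left (by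
      rw [← nhdsWithin_Ioo_eq_nhdsLT hab]; exact nhdsWithin_mono _ Ioo_subset_Icc_self)
  set I := ∫⁻ s in Ioo a b, ENNReal.ofReal (‖gradient e (θ s)‖ * ‖deriv θ s‖)
  obtain ⟨m, ham, hmb⟩ := exists_between hab
  have h1 : ∀ d, m < d → d < b → ENNReal.ofReal (e (θ a) - e (θ d)) ≤ I := fun d hmd hdb =>
    le_of_tendsto (ENNReal.tendsto_ofReal (hleft.sub_const _)) (by
      filter_upwards [Ioo_mem_nhdsGT ham] with c hc' using hinner c d hc'.1 (hc'.2.trans hmd).le hdb)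
  exact le_of_tendsto (ENNReal.tendsto_ofReal (hright.const_sub _)) (by
    filter_upwards [Ioo_mem_nhdsLT hmb] with d hd using h1 d hd.1 hd.2)

/-- The energy drop telescopes over the nodes of the partition. -/
theorem ofReal_sub_le_cost {E : ℝ → X → ℝ} {t : ℝ} (he : ContDiff ℝ 1 (E t)) (x y : X) :
    ENNReal.ofReal (E t x - E t y) ≤ cost E t x y := by
  by_cases hxy : x = y
  · simp [hxy]
  rw [cost, if_neg hxy]
  refine le_iInf₂ fun θ hθ => ?_
  obtain ⟨hc, h0, h1, j, τ, t1, t2, t3, t4, -, -⟩ := hθ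
  have hmono : MonotoneOn τ (Iic j) := by
    refine monotoneOn_of_le_add_one ordConnected_Iic fun a _ _ ha' => (t3 a ?_).le
    exact Nat.lt_of_succ_le ha'
  have hmain : ∀ i ≤ j, ENNReal.ofReal (E t (θ 0) - E t (θ (τ i))) ≤
      ∫⁻ s in Ioo 0 (τ i), ENNReal.ofReal (‖gradient (E t) (θ s)‖ * ‖deriv θ s‖) := by
    intro i
    induction i with
    | zero => simp [t1]
    | succ i ih =>
      intro hi
      have hi' : i < j := hi
      have hτ0 : 0 ≤ τ i := t1 ▸ hmono (Nat.zero_le j) hi'.le (Nat.zero_le i)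
      have hτ1 : τ (i + 1) ≤ 1 := t2 ▸ hmono hi (mem_Iic.2 le_rfl) hi
      rw [setLIntegral_Ioo_split _ hτ0 (t3 i hi').le]
      have h2 := ofReal_sub_le_lintegral he (t3 i hi')
        (hc.mono (Icc_subset_Icc hτ0 hτ1)) (t4 i hi')
      refine le_trans ?_ (add_le_add (ih hi'.le) h2)
      refine le_trans (ENNReal.ofReal_le_ofReal (le_of_eq ?_)) ENNReal.ofReal_add_le
      ring
  have := hmain j le_rfl
  rwa [t2, h0, h1] at this

end Cost

/-! ### Freezing time outside the interval, so that the end-points behave like interior times. -/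

section Clamp

/-- The projection of the line onto `[0,T]`. -/
noncomputable def clamp (T t : ℝ) : ℝ := max 0 (min t T)

theorem lipschitzWith_clamp (T : ℝ) : LipschitzWith 1 (clamp T) :=
  (LipschitzWith.id.min_const T).const_max 0

theorem continuous_clamp (T : ℝ) : Continuous (clamp T) := (lipschitzWith_clamp T).continuous

theorem clamp_mono (T : ℝ) : Monotone (clamp T) := fun _ _ h =>
  max_le_max le_rfl (min_le_min h le_rfl)

theorem clamp_mem {T : ℝ} (hT : 0 < T) (t : ℝ) : clamp T t ∈ Icc 0 T :=
  ⟨le_max_left _ _, max_le hT.le (min_le_right _ _)⟩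

theorem clamp_of_mem {T t : ℝ} (ht : t ∈ Icc 0 T) : clamp T t = t := by
  rw [clamp, min_eq_left ht.2, max_eq_right ht.1]

theorem clamp_of_nonpos {T t : ℝ} (ht : t ≤ 0) : clamp T t = 0 :=
  max_eq_left ((min_le_left _ _).trans ht)

theorem clamp_of_ge {T t : ℝ} (hT : 0 < T) (ht : T ≤ t) : clamp T t = T := by
  rw [clamp, min_eq_right ht, max_eq_right hT.le]

theorem clamp_clamp {T : ℝ} (hT : 0 < T) (t : ℝ) : clamp T (clamp T t) = clamp T t :=
  clamp_of_mem (clamp_mem hT t)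

/-- Strictness rules out `a` and `b` lying beyond the same end-point, the only case where clamping
leaves `[a,b]`. -/
theorem Icc_clamp_subset {T a b : ℝ} (hT : 0 < T) (h : clamp T a < clamp T b) :
    Icc (clamp T a) (clamp T b) ⊆ Icc a b := by
  have ha : a ≤ clamp T a := by
    rcases le_total T a with h' | h'
    · rw [clamp_of_ge hT h'] at h
      exact absurd h (not_lt.2 (clamp_mem hT b).2)
    · exact le_max_of_le_right (le_min le_rfl h')
  have hb : clamp T b ≤ b := by
    rcases le_total b 0 with h' | h'
    · rw [clamp_of_nonpos h'] at h
      exact absurd h (not_lt.2 (clamp_mem hT a).1)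
    · exact max_le h' (min_le_left _ _)
  exact Icc_subset_Icc ha hb

theorem continuous_comp_clamp {X Y : Type*} [TopologicalSpace X] [TopologicalSpace Y] {T : ℝ}
    (hT : 0 < T) {f : ℝ × X → Y} (hf : ContinuousOn f (Icc 0 T ×ˢ univ)) :
    Continuous fun p : ℝ × X => f (clamp T p.1, p.2) :=
  hf.comp_continuous (((continuous_clamp T).comp continuous_fst).prodMk continuous_snd)
    fun p => ⟨clamp_mem hT p.1, mem_univ _⟩

end Clamp

/-! ### Regularity of the energy, a priori bounds and the energy identity of the flows. -/

section Energy

variable {X : Type*} [NormedAddCommGroup X] [InnerProductSpace ℝ X] {T : ℝ} {E : ℝ → X → ℝ}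

theorem uniqueDiffOn_cylinder (hT : 0 < T) : UniqueDiffOn ℝ (Icc 0 T ×ˢ (univ : Set X)) :=
  (uniqueDiffOn_Icc hT).prod uniqueDiffOn_univ

theorem SmoothEnergy.hasFDerivWithinAt (hE : SmoothEnergy T E) {t : ℝ} (ht : t ∈ Icc 0 T) (x : X) :
    HasFDerivWithinAt (fun p : ℝ × X => E p.1 p.2)
      (fderivWithin ℝ (fun p : ℝ × X => E p.1 p.2) (Icc 0 T ×ˢ univ) (t, x))
      (Icc 0 T ×ˢ univ) (t, x) :=
  (hE.differentiableOn one_ne_zero (t, x) ⟨ht, mem_univ _⟩).hasFDerivWithinAt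

theorem SmoothEnergy.contDiff (hE : SmoothEnergy T E) {t : ℝ} (ht : t ∈ Icc 0 T) :
    ContDiff ℝ 1 (E t) := by
  have h : ContDiff ℝ 1 (fun x : X => (t, x)) := contDiff_const.prodMk contDiff_id
  exact contDiffOn_univ.1 (ContDiffOn.comp (g := fun p : ℝ × X => E p.1 p.2) hE h.contDiffOn
    fun x _ => ⟨ht, mem_univ _⟩)

theorem SmoothEnergy.continuous_clamp (hT : 0 < T) (hE : SmoothEnergy T E) :
    Continuous fun p : ℝ × X => E (clamp T p.1) p.2 :=
  continuous_comp_clamp hT (ContDiffOn.continuousOn hE)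

theorem SmoothEnergy.hasDerivWithinAt_time (hE : SmoothEnergy T E) {t : ℝ} (ht : t ∈ Icc 0 T)
    (x : X) : HasDerivWithinAt (fun s => E s x)
      (fderivWithin ℝ (fun p : ℝ × X => E p.1 p.2) (Icc 0 T ×ˢ univ) (t, x) (1, 0))
      (Icc 0 T) t := by
  have hmaps : MapsTo (fun s : ℝ => (s, x)) (Icc 0 T) (Icc 0 T ×ˢ univ) :=
    fun _ hs => ⟨hs, mem_univ _⟩
  have h := (hE.hasFDerivWithinAt ht x).comp_hasDerivWithinAt t
    ((hasDerivWithinAt_id t _).prodMk (hasDerivWithinAt_const t _ x)) hmaps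
  exact h

theorem SmoothEnergy.power_eq (hT : 0 < T) (hE : SmoothEnergy T E) {t : ℝ} (ht : t ∈ Icc 0 T)
    (x : X) : power T E t x =
      fderivWithin ℝ (fun p : ℝ × X => E p.1 p.2) (Icc 0 T ×ˢ univ) (t, x) (1, 0) :=
  (hE.hasDerivWithinAt_time ht x).derivWithin (uniqueDiffOn_Icc hT t ht)

theorem SmoothEnergy.continuousOn_power (hT : 0 < T) (hE : SmoothEnergy T E) :
    ContinuousOn (fun p : ℝ × X => power T E p.1 p.2) (Icc 0 T ×ˢ univ) := by
  have h := hE.continuousOn_fderivWithin (uniqueDiffOn_cylinder hT) le_rfl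
  exact ContinuousOn.congr (h.clm_apply continuousOn_const) fun p hp => hE.power_eq hT hp.1 p.2

theorem le_mul_exp_of_deriv_le {z z' : ℝ → ℝ} {c : ℝ}
    (hz : ∀ t ∈ Icc 0 T, HasDerivWithinAt z (z' t) (Icc 0 T) t)
    (hle : ∀ t ∈ Icc 0 T, z' t ≤ c * z t) {s t : ℝ} (hs : 0 ≤ s) (hst : s ≤ t) (ht : t ≤ T) :
    z t ≤ z s * Real.exp (c * (t - s)) := by
  have hd : ∀ r ∈ Icc 0 T, HasDerivWithinAt (fun r => z r * Real.exp (-(c * r)))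
      ((z' r - c * z r) * Real.exp (-(c * r))) (Icc 0 T) r := fun r hr => by
    have h1 : HasDerivAt (fun r => Real.exp (-(c * r))) (Real.exp (-(c * r)) * -(c * 1)) r :=
      (((hasDerivAt_id r).const_mul c).neg).exp
    refine ((hz r hr).mul h1.hasDerivWithinAt).congr_deriv ?_
    ring
  have hanti : AntitoneOn (fun r => z r * Real.exp (-(c * r))) (Icc 0 T) := by
    refine antitoneOn_of_hasDerivWithinAt_nonpos
      (f' := fun r => (z' r - c * z r) * Real.exp (-(c * r))) (convex_Icc 0 T)
      (fun r hr => (hd r hr).continuousWithinAt)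
      (fun r hr => (hd r (interior_subset hr)).mono interior_subset) fun r hr => ?_
    exact mul_nonpos_of_nonpos_of_nonneg (sub_nonpos.2 (hle r (interior_subset hr)))
      (Real.exp_pos _).le
  have h := hanti ⟨hs, hst.trans ht⟩ ⟨hs.trans hst, ht⟩ hst
  simp only at h
  calc z t = z t * Real.exp (-(c * t)) * Real.exp (c * t) := by
        rw [mul_assoc, ← Real.exp_add]; simp
    _ ≤ z s * Real.exp (-(c * s)) * Real.exp (c * t) := by gcongr
    _ = z s * Real.exp (c * (t - s)) := by
        rw [mul_assoc, ← Real.exp_add]; congr 2; ring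

/-- The quantity `q = C₁ * E + C₂` is nonnegative and satisfies `|q'| ≤ C₁ * q`, so Gronwall works
in both time directions. This turns a bound at one time into the bound at all times that coercivity
asks for. -/
theorem SmoothEnergy.shifted_energy_le (hT : 0 < T) (hE : SmoothEnergy T E) {C₁ C₂ : ℝ}
    (hC₁ : 0 < C₁)
    (hpow : ∀ t ∈ Icc 0 T, ∀ u : X, |power T E t u| ≤ C₁ * E t u + C₂) (x : X) {s t : ℝ}
    (hs : s ∈ Icc 0 T) (ht : t ∈ Icc 0 T) :
    C₁ * E s x + C₂ ≤ (C₁ * E t x + C₂) * Real.exp (C₁ * T) := by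
  have hd : ∀ r ∈ Icc 0 T, HasDerivWithinAt (fun r => C₁ * E r x + C₂) (C₁ * power T E r x)
      (Icc 0 T) r := fun r hr => by
    rw [hE.power_eq hT hr]
    exact ((hE.hasDerivWithinAt_time hr x).const_mul C₁).add_const C₂
  have hq : 0 ≤ C₁ * E t x + C₂ := (abs_nonneg _).trans (hpow t ht x)
  rcases le_total s t with hst | hst
  · have h := le_mul_exp_of_deriv_le (c := -C₁) (fun r hr => (hd r hr).neg) (fun r hr => by
      have := (abs_le.1 (hpow r hr x)).1
      simp only [Pi.neg_apply]
      nlinarith) hs.1 hst ht.2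
    simp only [Pi.neg_apply] at h
    have h2 : (C₁ * E s x + C₂) * Real.exp (-C₁ * (t - s)) ≤ C₁ * E t x + C₂ := by linarith
    calc C₁ * E s x + C₂
        = (C₁ * E s x + C₂) * Real.exp (-C₁ * (t - s)) * Real.exp (C₁ * (t - s)) := by
          rw [mul_assoc, ← Real.exp_add]; simp
      _ ≤ (C₁ * E t x + C₂) * Real.exp (C₁ * T) := by
          gcongr
          linarith [hs.1, ht.2]
  · have h := le_mul_exp_of_deriv_le (c := C₁) hd (fun r hr => by
      have := (abs_le.1 (hpow r hr x)).2
      nlinarith) ht.1 hst hs.2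
    refine h.trans ?_
    gcongr
    linarith [ht.1, hs.2]

theorem SmoothEnergy.continuous_power_clamp (hT : 0 < T) (hE : SmoothEnergy T E) :
    Continuous fun p : ℝ × X => power T E (clamp T p.1) p.2 :=
  continuous_comp_clamp hT (hE.continuousOn_power hT)

variable [CompleteSpace X]

theorem SmoothEnergy.gradient_eq (hE : SmoothEnergy T E) {t : ℝ} (ht : t ∈ Icc 0 T) (x : X) :
    gradient (E t) x = (InnerProductSpace.toDual ℝ X).symm
      ((fderivWithin ℝ (fun p : ℝ × X => E p.1 p.2) (Icc 0 T ×ˢ univ) (t, x)).comp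
        (ContinuousLinearMap.inr ℝ ℝ X)) := by
  have h := (hE.hasFDerivWithinAt ht x).comp (s := univ) x
    ((hasFDerivAt_prodMk_right t x).hasFDerivWithinAt) fun y _ => ⟨ht, mem_univ _⟩
  rw [hasFDerivWithinAt_univ] at h
  rw [gradient]
  congr 1
  exact h.fderiv

theorem SmoothEnergy.continuousOn_gradient (hT : 0 < T) (hE : SmoothEnergy T E) :
    ContinuousOn (fun p : ℝ × X => gradient (E p.1) p.2) (Icc 0 T ×ˢ univ) := by
  have h := hE.continuousOn_fderivWithin (uniqueDiffOn_cylinder hT) le_rfl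
  refine ContinuousOn.congr ?_ fun p hp => hE.gradient_eq hp.1 p.2
  exact (InnerProductSpace.toDual ℝ X).symm.continuous.comp_continuousOn
    (h.clm_comp continuousOn_const)

theorem SmoothEnergy.hasDerivWithinAt_comp (hT : 0 < T) (hE : SmoothEnergy T E) {u : ℝ → X}
    {t : ℝ} (ht : t ∈ Icc 0 T) {v : X} (hu : HasDerivWithinAt u v (Icc 0 T) t) :
    HasDerivWithinAt (fun s => E s (u s))
      (power T E t (u t) + inner ℝ (gradient (E t) (u t)) v) (Icc 0 T) t := by
  have hmaps : MapsTo (fun s : ℝ => (s, u s)) (Icc 0 T) (Icc 0 T ×ˢ univ) :=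
    fun _ hs => ⟨hs, mem_univ _⟩
  have h := (hE.hasFDerivWithinAt ht (u t)).comp_hasDerivWithinAt t
    ((hasDerivWithinAt_id t _).prodMk hu) hmaps
  refine h.congr_deriv ?_
  rw [hE.power_eq hT ht, hE.gradient_eq ht, InnerProductSpace.toDual_symm_apply]
  simp only [ContinuousLinearMap.comp_apply, ContinuousLinearMap.inr_apply, ← map_add]
  simp

/-- The slope field `D𝓔`, frozen in time outside `[0,T]`. -/
noncomputable def slopeField (T : ℝ) (E : ℝ → X → ℝ) (t : ℝ) (x : X) : X :=
  gradient (E (clamp T t)) x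

theorem SmoothEnergy.continuous_slopeField (hT : 0 < T) (hE : SmoothEnergy T E) :
    Continuous fun p : ℝ × X => slopeField T E p.1 p.2 :=
  continuous_comp_clamp hT (hE.continuousOn_gradient hT)

theorem IsolatedCriticalPoints.isolatedZeros (hT : 0 < T) (h : IsolatedCriticalPoints T E) (t : ℝ) :
    IsolatedZeros (slopeField T E t) :=
  fun v hv => h _ (clamp_mem hT t) v hv

theorem IsGradientFlow.continuousOn {ε : ℝ} {u : ℝ → X} (hT : 0 < T)
    (hu : IsGradientFlow T E ε u) : ContinuousOn u (Icc 0 T) := by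
  obtain ⟨v, hv, hint, -⟩ := hu
  have hv1 : IntegrableOn v (Icc 0 T) := by
    rw [integrableOn_Icc_iff_integrableOn_Ioo]
    exact hv.integrable one_le_two
  have : ContinuousOn (fun t => u 0 + ∫ r in (0 : ℝ)..t, v r) (Icc 0 T) := by
    have := intervalIntegral.continuousOn_primitive_interval (μ := volume) (f := v) (a := 0) (b := T)
      (by rwa [uIcc_of_le hT.le])
    rw [uIcc_of_le hT.le] at this
    exact continuousOn_const.add this
  exact this.congr hint

theorem IsGradientFlow.continuous_clamp {ε : ℝ} {u : ℝ → X} (hT : 0 < T)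
    (hu : IsGradientFlow T E ε u) : Continuous fun t => u (clamp T t) :=
  (hu.continuousOn hT).comp_continuous (_root_.continuous_clamp T) (clamp_mem hT)

theorem IsGradientFlow.continuous_slope {ε : ℝ} {u : ℝ → X} (hT : 0 < T) (hE : SmoothEnergy T E)
    (hu : IsGradientFlow T E ε u) : Continuous fun r => slopeField T E r (u (clamp T r)) :=
  (hE.continuous_slopeField hT).comp (continuous_id.prodMk (hu.continuous_clamp hT))

theorem IsGradientFlow.eq_integral {ε : ℝ} {u : ℝ → X} (hε : 0 < ε)
    (hu : IsGradientFlow T E ε u) {t : ℝ} (ht : t ∈ Icc 0 T) :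
    u t = u 0 + ∫ r in (0 : ℝ)..t, -(ε⁻¹ • slopeField T E r (u (clamp T r))) := by
  obtain ⟨v, hv, hint, hae⟩ := hu
  rw [hint t ht]
  congr 1
  rw [intervalIntegral.integral_of_le ht.1, intervalIntegral.integral_of_le ht.1,
    integral_Ioc_eq_integral_Ioo, integral_Ioc_eq_integral_Ioo]
  refine setIntegral_congr_ae measurableSet_Ioo ?_
  have := (ae_restrict_iff' measurableSet_Ioo).1 hae
  filter_upwards [this] with r hr hrt
  have hr' : r ∈ Ioo 0 T := ⟨hrt.1, hrt.2.trans_le ht.2⟩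
  have h := hr hr'
  rw [slopeField, clamp_of_mem (Ioo_subset_Icc_self hr'), ← smul_neg, ← eq_neg_of_add_eq_zero_left h,
    smul_smul, inv_mul_cancel₀ hε.ne', one_smul]

/-- The weak derivative agrees a.e. with a continuous function, so the equation holds classically up
to the end-points. -/
theorem IsGradientFlow.hasDerivWithinAt {ε : ℝ} {u : ℝ → X} (hT : 0 < T) (hE : SmoothEnergy T E)
    (hε : 0 < ε) (hu : IsGradientFlow T E ε u) {t : ℝ} (ht : t ∈ Icc 0 T) :
    HasDerivWithinAt u (-(ε⁻¹ • slopeField T E t (u (clamp T t)))) (Icc 0 T) t := by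
  have hc : Continuous fun r => -(ε⁻¹ • slopeField T E r (u (clamp T r))) :=
    ((hu.continuous_slope hT hE).const_smul ε⁻¹).neg
  have h := (intervalIntegral.integral_hasDerivAt_right (hc.intervalIntegrable 0 t)
    (hc.stronglyMeasurableAtFilter _ _) hc.continuousAt).const_add (u 0)
  exact h.hasDerivWithinAt.congr (fun s hs => hu.eq_integral hε hs) (hu.eq_integral hε ht)

/-- The energy dissipated by a gradient flow up to time `t`. -/
noncomputable def dissipated (T : ℝ) (E : ℝ → X → ℝ) (ε : ℝ) (u : ℝ → X) (t : ℝ) : ℝ :=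
  ∫ r in (0 : ℝ)..clamp T t, ε⁻¹ * ‖slopeField T E r (u (clamp T r))‖ ^ 2

theorem IsGradientFlow.dissipated_sub {ε : ℝ} {u : ℝ → X} (hT : 0 < T) (hE : SmoothEnergy T E)
    (hu : IsGradientFlow T E ε u) (a b : ℝ) :
    dissipated T E ε u b - dissipated T E ε u a =
      ∫ r in clamp T a..clamp T b, ε⁻¹ * ‖slopeField T E r (u (clamp T r))‖ ^ 2 := by
  have hc : Continuous fun r => ε⁻¹ * ‖slopeField T E r (u (clamp T r))‖ ^ 2 :=
    continuous_const.mul ((hu.continuous_slope hT hE).norm.pow 2)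
  exact intervalIntegral.integral_interval_sub_left (hc.intervalIntegrable _ _)
    (hc.intervalIntegrable _ _)

theorem IsGradientFlow.dissipated_eq {ε : ℝ} {u : ℝ → X} (hT : 0 < T) (hE : SmoothEnergy T E)
    (hε : 0 < ε) (hu : IsGradientFlow T E ε u) (t : ℝ) :
    dissipated T E ε u t = E 0 (u 0) +
      (∫ r in (0 : ℝ)..clamp T t, power T E (clamp T r) (u (clamp T r))) -
      E (clamp T t) (u (clamp T t)) := by
  have hc : Continuous fun r => ε⁻¹ * ‖slopeField T E r (u (clamp T r))‖ ^ 2 :=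
    continuous_const.mul ((hu.continuous_slope hT hE).norm.pow 2)
  have hp : Continuous fun r => power T E (clamp T r) (u (clamp T r)) :=
    (hE.continuous_power_clamp hT).comp (continuous_id.prodMk (hu.continuous_clamp hT))
  have hmem := clamp_mem hT t
  have hd : ∀ r ∈ Icc 0 T, HasDerivWithinAt (fun s => E s (u s))
      (power T E (clamp T r) (u (clamp T r)) - ε⁻¹ * ‖slopeField T E r (u (clamp T r))‖ ^ 2)
      (Icc 0 T) r := fun r hr => by
    refine (hE.hasDerivWithinAt_comp hT hr (hu.hasDerivWithinAt hT hE hε hr)).congr_deriv ?_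
    rw [slopeField, clamp_of_mem hr, inner_neg_right, inner_smul_right,
      real_inner_self_eq_norm_sq]
    ring
  have hftc := intervalIntegral.integral_eq_sub_of_hasDeriv_right_of_le hmem.1
    (f := fun s => E s (u s))
    (fun r hr => ((hd r ⟨hr.1, hr.2.trans hmem.2⟩).continuousWithinAt).mono
      (Icc_subset_Icc_right hmem.2))
    (fun r hr => ((hd r ⟨hr.1.le, hr.2.le.trans hmem.2⟩).hasDerivAt
      (Icc_mem_nhds hr.1 (hr.2.trans_le hmem.2))).hasDerivWithinAt)
    ((hp.sub hc).intervalIntegrable _ _)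
  rw [intervalIntegral.integral_sub (hp.intervalIntegrable _ _) (hc.intervalIntegrable _ _)] at hftc
  rw [dissipated]
  linarith

theorem IsGradientFlow.dissipationBound {ε : ℝ} {u : ℝ → X} (hT : 0 < T) (hE : SmoothEnergy T E)
    (hε : 0 < ε) (hu : IsGradientFlow T E ε u) :
    DissipationBound (slopeField T E) (fun t => u (clamp T t)) (dissipated T E ε u) where
  cont := hu.continuous_clamp hT
  mono a b hab := by
    rw [← sub_nonneg, hu.dissipated_sub hT hE]
    exact intervalIntegral.integral_nonneg (clamp_mono T hab) fun r _ => by positivity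
  le a b m hab hm h := by
    have hs := hu.continuous_slope hT hE
    have hab' := clamp_mono T hab
    have hc : Continuous fun r => -(ε⁻¹ • slopeField T E r (u (clamp T r))) :=
      (hs.const_smul ε⁻¹).neg
    rw [hu.dissipated_sub hT hE]
    rcases hab'.eq_or_lt with heq | hlt
    · simp [heq]
    have hsub := Icc_clamp_subset hT hlt
    have e : u (clamp T b) - u (clamp T a) =
        ∫ r in clamp T a..clamp T b, -(ε⁻¹ • slopeField T E r (u (clamp T r))) := by
      rw [hu.eq_integral hε (clamp_mem hT b), hu.eq_integral hε (clamp_mem hT a),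
        add_sub_add_left_eq_sub,
        intervalIntegral.integral_interval_sub_left (hc.intervalIntegrable _ _)
          (hc.intervalIntegrable _ _)]
    rw [e]
    calc m * ‖∫ r in clamp T a..clamp T b, -(ε⁻¹ • slopeField T E r (u (clamp T r)))‖
        ≤ m * ∫ r in clamp T a..clamp T b, ‖-(ε⁻¹ • slopeField T E r (u (clamp T r)))‖ := by
          gcongr
          exact intervalIntegral.norm_integral_le_integral_norm hab'
      _ = ∫ r in clamp T a..clamp T b, m * ‖-(ε⁻¹ • slopeField T E r (u (clamp T r)))‖ :=
          (intervalIntegral.integral_const_mul _ _).symm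
      _ ≤ _ := by
          refine intervalIntegral.integral_mono_on hab'
            ((continuous_const.mul hc.norm).intervalIntegrable _ _)
            ((continuous_const.mul (hs.norm.pow 2)).intervalIntegrable _ _) fun r hr => ?_
          -- The speed is `ε⁻¹‖D𝓔‖`, so `m` times the speed is at most `ε⁻¹‖D𝓔‖²` wherever the slope
          -- is at least `m`.
          rw [norm_neg, norm_smul, norm_inv, Real.norm_of_nonneg hε.le]
          have := h r (hsub hr)
          calc m * (ε⁻¹ * ‖slopeField T E r (u (clamp T r))‖)
              = ε⁻¹ * (m * ‖slopeField T E r (u (clamp T r))‖) := by ring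
            _ ≤ ε⁻¹ * (‖slopeField T E r (u (clamp T r))‖ *
                  ‖slopeField T E r (u (clamp T r))‖) := by gcongr
            _ = _ := by ring

theorem IsGradientFlow.exists_lipschitzWith_clamp {ε : ℝ} {u : ℝ → X} (hT : 0 < T)
    (hE : SmoothEnergy T E) (hε : 0 < ε) (hu : IsGradientFlow T E ε u) :
    ∃ K, LipschitzWith K fun t => u (clamp T t) := by
  have hc : Continuous fun r => -(ε⁻¹ • slopeField T E r (u (clamp T r))) :=
    ((hu.continuous_slope hT hE).const_smul ε⁻¹).neg
  obtain ⟨C, hC⟩ := (isCompact_Icc (a := 0) (b := T)).exists_bound_of_continuousOn hc.continuousOn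
  have hC0 : 0 ≤ C := (norm_nonneg _).trans (hC 0 ⟨le_rfl, hT.le⟩)
  have h := (convex_Icc 0 T).lipschitzOnWith_of_nnnorm_hasDerivWithin_le (C := C.toNNReal)
    (fun r hr => hu.hasDerivWithinAt hT hE hε hr)
    fun r hr => by
      rw [← NNReal.coe_le_coe, coe_nnnorm, Real.coe_toNNReal _ hC0]
      exact hC r hr
  refine ⟨C.toNNReal * 1, fun a b => ?_⟩
  exact (h.comp (lipschitzWith_clamp T).lipschitzOnWith fun r _ => clamp_mem hT r)
    (mem_univ a) (mem_univ b)

theorem exists_norm_bound_of_initial_energy (hT : 0 < T) (hE0 : SmoothEnergy T E)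
    (hE1 : Coercive T E) (hE2 : PowerControl T E) (A : ℝ) :
    ∃ R, ∀ ε > 0, ∀ u, IsGradientFlow T E ε u → E 0 (u 0) ≤ A → ∀ t ∈ Icc 0 T, ‖u t‖ ≤ R := by
  obtain ⟨C₁, C₂, hC₁, hC₂, hpow⟩ := hE2
  -- One exponential for growth along the flow, a second for changing the time at which the energy
  -- of a fixed state is evaluated.
  set Q : ℝ := (C₁ * A + C₂) * Real.exp (C₁ * T) * Real.exp (C₁ * T)
  obtain ⟨R, hR⟩ := (hE1 ((|Q| + C₂) / C₁) (by positivity)).exists_norm_le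
  refine ⟨R, fun ε hε u hu hA t ht => hR _ ?_⟩
  have hflow : C₁ * E t (u t) + C₂ ≤ (C₁ * A + C₂) * Real.exp (C₁ * T) := by
    have hd : ∀ r ∈ Icc 0 T, HasDerivWithinAt (fun r => C₁ * E r (u r) + C₂)
        (C₁ * (power T E r (u r) +
          inner ℝ (gradient (E r) (u r)) (-(ε⁻¹ • slopeField T E r (u (clamp T r))))))
        (Icc 0 T) r := fun r hr =>
      ((hE0.hasDerivWithinAt_comp hT hr (hu.hasDerivWithinAt hT hE0 hε hr)).const_mul C₁).add_const
        C₂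
    have h := le_mul_exp_of_deriv_le (c := C₁) hd (fun r hr => by
      rw [slopeField, clamp_of_mem hr, inner_neg_right, inner_smul_right,
        real_inner_self_eq_norm_sq]
      have h1 := (abs_le.1 (hpow r hr (u r))).2
      have h2 : 0 ≤ ε⁻¹ * ‖gradient (E r) (u r)‖ ^ 2 := by positivity
      exact mul_le_mul_of_nonneg_left (by linarith) hC₁.le) le_rfl ht.1 ht.2
    have h0 : 0 ≤ C₁ * E 0 (u 0) + C₂ := (abs_nonneg _).trans (hpow 0 ⟨le_rfl, hT.le⟩ (u 0))
    have hA' : C₁ * E 0 (u 0) ≤ C₁ * A := mul_le_mul_of_nonneg_left hA hC₁.le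
    refine h.trans (mul_le_mul (by linarith) (Real.exp_le_exp.2 ?_) (Real.exp_pos _).le
      (by linarith))
    exact mul_le_mul_of_nonneg_left (by linarith [ht.2]) hC₁.le
  have : Nonempty (Icc (0 : ℝ) T) := ⟨⟨t, ht⟩⟩
  change (⨆ s : Icc (0 : ℝ) T, |E s (u t)|) ≤ _
  refine ciSup_le fun s => ?_
  have h1 := hE0.shifted_energy_le hT hC₁ hpow (u t) s.2 ht
  have h2 : 0 ≤ C₁ * E s (u t) + C₂ := (abs_nonneg _).trans (hpow s s.2 (u t))
  have h3 : C₁ * E s (u t) + C₂ ≤ Q := h1.trans (mul_le_mul_of_nonneg_right hflow (Real.exp_pos _).le)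
  rw [le_div_iff₀' hC₁, ← abs_of_pos hC₁, ← abs_mul, abs_le]
  constructor <;> linarith [abs_nonneg Q, le_abs_self Q]

theorem slopeField_of_mem {t : ℝ} (ht : t ∈ Icc 0 T) : slopeField T E t = gradient (E t) := by
  ext x; rw [slopeField, clamp_of_mem ht]

theorem SmoothEnergy.continuous_slopeField_right (hT : 0 < T) (hE : SmoothEnergy T E) (t : ℝ) :
    Continuous (slopeField T E t) :=
  (hE.continuous_slopeField hT).comp (by fun_prop : Continuous fun x => (t, x))

end Energy

/-! ### Flows as nearly optimal competitors at a frozen time. -/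

section JumpCost

variable {X : Type*} [NormedAddCommGroup X] [InnerProductSpace ℝ X] [FiniteDimensional ℝ X]
  [CompleteSpace X] {T : ℝ} {E : ℝ → X → ℝ}

theorem exists_joinable_of_flow (hT : 0 < T) (hE : SmoothEnergy T E)
    (hi : IsolatedCriticalPoints T E) (R t : ℝ) {η : ℝ} (hη : 0 < η) :
    ∃ δ > 0, ∀ ε > 0, ∀ u, IsGradientFlow T E ε u → (∀ r ∈ Icc 0 T, ‖u r‖ ≤ R) →
      ∀ α β, 0 ≤ α → α ≤ β → β ≤ T → |α - t| ≤ δ → |β - t| ≤ δ →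
        Joinable (slopeField T E t) (u α) (u β)
          (ENNReal.ofReal ((1 + η) * (dissipated T E ε u β - dissipated T E ε u α) + η)) := by
  have : ProperSpace X := FiniteDimensional.proper_real X
  have hg := hE.continuous_slopeField_right hT t
  have hiz := hi.isolatedZeros hT t
  have hfin := hiz.finite_inter_closedBall hg R
  obtain ⟨r, hr, hsep⟩ := hiz.exists_separation hfin fun c hc => hc.2
  obtain ⟨M, hM⟩ := (isCompact_closedBall (0 : X) (R + 1)).exists_bound_of_continuousOn
    hg.continuousOn
  set N : ℝ := 2 ^ hfin.toFinset.card with hN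
  have hN1 : 1 ≤ N := one_le_pow₀ one_le_two
  -- `ρ` is so small that all detours together cost at most `η`; `ρ ≤ 1` keeps the balls where `M`
  -- bounds the slope.
  obtain ⟨ρ, hρ, hρ1, hρr, hρη⟩ : ∃ ρ > 0, ρ ≤ 1 ∧ ρ < r ∧ N * (2 * (|M| + 1) * ρ) ≤ η := by
    refine ⟨min (min 1 (r / 2)) (η / (N * (2 * (|M| + 1)))), by positivity,
      (min_le_left _ _).trans (min_le_left _ _),
      ((min_le_left _ _).trans (min_le_right _ _)).trans_lt (half_lt_self hr), ?_⟩
    have := min_le_right (min 1 (r / 2)) (η / (N * (2 * (|M| + 1))))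
    rw [le_div_iff₀ (by positivity)] at this
    linarith
  obtain ⟨m, hm, hlow⟩ := exists_slope_lower_bound hg R hρ
  -- With frozen slope at least `m`, a time variation of `η * m / (1 + η)` is at most the fraction
  -- `η / (1 + η)` of it, which gives the factor `1 + η` between the frozen and actual slopes.
  obtain ⟨δ, hδ, hmod⟩ := exists_uniform_time_modulus (hE.continuous_slopeField hT) R t
    (show 0 < η * m / (1 + η) by positivity)
  refine ⟨δ, hδ, fun ε hε u hu hR α β hα hαβ hβ hαt hβt => ?_⟩
  obtain ⟨K, hK⟩ := hu.exists_lipschitzWith_clamp hT hE hε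
  have hmono : Monotone fun s => (1 + η) * dissipated T E ε u s :=
    (hu.dissipationBound hT hE hε).mono.const_mul (by positivity)
  have hRc : ∀ s, ‖u (clamp T s)‖ ≤ R := fun s => hR _ (clamp_mem hT s)
  have h := joinable_of_avoidance hK (F := hfin.toFinset) hρ hρr
    (show 0 ≤ |M| + 1 by positivity)
    (fun c hc z hz => (hM z (by
      rw [Finite.mem_toFinset] at hc
      have h1 := hc.1
      rw [mem_closedBall_zero_iff] at h1 ⊢
      rw [dist_eq_norm] at hz
      have := norm_sub_norm_le z c
      linarith)).trans (by linarith [le_abs_self M]))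
    (fun c hc => hsep c (by rwa [Finite.mem_toFinset] at hc)) hmono (a₀ := α) (b₀ := β)
    (fun s _ h0 => by
      rw [Finite.mem_toFinset]
      exact ⟨by simpa using hRc s, h0⟩)
    (fun a b ha hab hb hav => by
      have hs := hu.continuous_slope hT hE
      have hint : IntegrableOn
          (fun s => (1 + η) * (ε⁻¹ * ‖slopeField T E s (u (clamp T s))‖ ^ 2)) (Ioo a b) :=
        (((continuous_const.mul (continuous_const.mul (hs.norm.pow 2))).integrableOn_Icc).mono_set
          Ioo_subset_Icc_self)
      have ha0 := hα.trans ha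
      have hbT := hb.trans hβ
      rw [← mul_sub, hu.dissipated_sub hT hE, clamp_of_mem ⟨ha0, hab.trans hbT⟩,
        clamp_of_mem ⟨ha0.trans hab, hbT⟩, ← intervalIntegral.integral_const_mul,
        intervalIntegral.integral_of_le hab, integral_Ioc_eq_integral_Ioo,
        ofReal_integral_eq_lintegral_ofReal hint
          (Eventually.of_forall fun s => by simp only [Pi.zero_apply]; positivity)]
      refine setLIntegral_mono' measurableSet_Ioo fun s hs => ENNReal.ofReal_le_ofReal ?_
      have hs0 : s ∈ Ioo 0 T := ⟨ha0.trans_lt hs.1, hs.2.trans_le hbT⟩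
      have hnhds : Icc 0 T ∈ 𝓝 s := Icc_mem_nhds hs0.1 hs0.2
      have heq : (fun r => u (clamp T r)) =ᶠ[𝓝 s] u := by
        filter_upwards [hnhds] with r hr' using by rw [clamp_of_mem hr']
      rw [heq.deriv_eq,
        ((hu.hasDerivWithinAt hT hE hε (Ioo_subset_Icc_self hs0)).hasDerivAt hnhds).deriv,
        norm_neg, norm_smul, norm_inv, Real.norm_of_nonneg hε.le]
      have h1 : m ≤ ‖slopeField T E t (u (clamp T s))‖ := hlow _ (hRc s) fun c hc hc0 =>
        hav s hs c (by rw [Finite.mem_toFinset]; exact ⟨by simpa using hc, hc0⟩)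
      have h2 := hmod s (abs_le.2 ⟨by linarith [(abs_le.1 hαt).1, hs.1],
        by linarith [(abs_le.1 hβt).2, hs.2]⟩) (u (clamp T s)) (hRc s)
      have h3 := norm_sub_norm_le (slopeField T E t (u (clamp T s)))
        (slopeField T E s (u (clamp T s)))
      rw [norm_sub_rev] at h3
      have h4 : ‖slopeField T E t (u (clamp T s))‖ ≤
          (1 + η) * ‖slopeField T E s (u (clamp T s))‖ := by
        have h5 := h3.trans h2
        rw [le_div_iff₀ (by positivity)] at h5
        nlinarith
      calc ‖slopeField T E t (u (clamp T s))‖ * (ε⁻¹ * ‖slopeField T E s (u (clamp T s))‖)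
          ≤ (1 + η) * ‖slopeField T E s (u (clamp T s))‖ *
              (ε⁻¹ * ‖slopeField T E s (u (clamp T s))‖) := by gcongr
        _ = _ := by ring)
    hfin.toFinset α β le_rfl hαβ le_rfl (fun s _ c hc hc' => absurd hc hc')
  rw [clamp_of_mem ⟨hα, hαβ.trans hβ⟩, clamp_of_mem ⟨hα.trans hαβ, hβ⟩] at h
  refine h.mono (ENNReal.ofReal_le_ofReal ?_)
  have hMρ : 0 ≤ 2 * (|M| + 1) * ρ := by positivity
  rw [← hN]
  nlinarith

end JumpCost

/-! ### Properties of the pointwise limit. -/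

section Limit

variable {X : Type*} [NormedAddCommGroup X] [InnerProductSpace ℝ X] [CompleteSpace X]

/-- `v` is the pointwise limit of the gradient flows `u n`, frozen in time outside `[0,T]`. -/
structure IsFlowLimit (T : ℝ) (E : ℝ → X → ℝ) (ε : ℕ → ℝ) (u : ℕ → ℝ → X) (R : ℝ)
    (v : ℝ → X) : Prop where
  pos : 0 < T
  smooth : SmoothEnergy T E
  isolated : IsolatedCriticalPoints T E
  eps_pos : ∀ n, 0 < ε n
  eps_lim : Tendsto ε atTop (𝓝 0)
  flow : ∀ n, IsGradientFlow T E (ε n) (u n)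
  bound : ∀ n, ∀ t ∈ Icc 0 T, ‖u n t‖ ≤ R
  lim : ∀ t, Tendsto (fun n => u n (clamp T t)) atTop (𝓝 (v t))

/-- The limit of the dissipated energies. -/
noncomputable def limitDissipated (T : ℝ) (E : ℝ → X → ℝ) (v : ℝ → X) (t : ℝ) : ℝ :=
  E 0 (v 0) + (∫ r in (0 : ℝ)..clamp T t, power T E (clamp T r) (v r)) - E (clamp T t) (v t)

variable {T : ℝ} {E : ℝ → X → ℝ} {ε : ℕ → ℝ} {u : ℕ → ℝ → X} {R : ℝ} {v : ℝ → X}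

namespace IsFlowLimit

theorem lim_of_mem (h : IsFlowLimit T E ε u R v) {t : ℝ} (ht : t ∈ Icc 0 T) :
    Tendsto (fun n => u n t) atTop (𝓝 (v t)) := by
  have := h.lim t
  rwa [clamp_of_mem ht] at this

theorem apply_clamp (h : IsFlowLimit T E ε u R v) (t : ℝ) : v (clamp T t) = v t :=
  tendsto_nhds_unique (h.lim_of_mem (clamp_mem h.pos t)) (h.lim t)

theorem bound_clamp (h : IsFlowLimit T E ε u R v) (n : ℕ) (t : ℝ) : ‖u n (clamp T t)‖ ≤ R :=
  h.bound n _ (clamp_mem h.pos t)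

theorem norm_le (h : IsFlowLimit T E ε u R v) (t : ℝ) : ‖v t‖ ≤ R :=
  le_of_tendsto (h.lim t).norm (Eventually.of_forall fun n => h.bound_clamp n t)

theorem stronglyMeasurable (h : IsFlowLimit T E ε u R v) : StronglyMeasurable v :=
  stronglyMeasurable_of_tendsto atTop
    (fun n => ((h.flow n).continuous_clamp h.pos).stronglyMeasurable) (tendsto_pi_nhds.2 h.lim)

/-- Passing to the limit in integrals of continuous functions of the flow. -/
theorem tendsto_integral [FiniteDimensional ℝ X] (h : IsFlowLimit T E ε u R v) {f : ℝ × X → ℝ}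
    (hf : Continuous f) (a b : ℝ) :
    (∀ a b, IntervalIntegrable (fun r => f (r, v r)) volume a b) ∧
    Tendsto (fun n => ∫ r in a..b, f (r, u n (clamp T r))) atTop (𝓝 (∫ r in a..b, f (r, v r))) := by
  have : ProperSpace X := FiniteDimensional.proper_real X
  have hbd : ∀ a b : ℝ, ∃ C, ∀ r ∈ uIoc a b, ∀ x, ‖x‖ ≤ R → ‖f (r, x)‖ ≤ C := fun a b => by
    obtain ⟨C, hC⟩ := ((isCompact_uIcc (a := a) (b := b)).prod
      (isCompact_closedBall (0 : X) R)).exists_bound_of_continuousOn hf.continuousOn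
    exact ⟨C, fun r hr x hx => hC (r, x) ⟨uIoc_subset_uIcc hr, by simpa using hx⟩⟩
  have hmeas : StronglyMeasurable fun r => f (r, v r) :=
    hf.comp_stronglyMeasurable (stronglyMeasurable_id.prodMk h.stronglyMeasurable)
  refine ⟨fun a b => ?_, ?_⟩
  · obtain ⟨C, hC⟩ := hbd a b
    refine (intervalIntegrable_const (c := C)).mono_fun hmeas.aestronglyMeasurable
      ((ae_restrict_iff' measurableSet_uIoc).2 (Eventually.of_forall fun r hr => ?_))
    exact (hC r hr _ (h.norm_le r)).trans (le_abs_self C)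
  · obtain ⟨C, hC⟩ := hbd a b
    refine intervalIntegral.tendsto_integral_filter_of_dominated_convergence (fun _ => C)
      (Eventually.of_forall fun n => ?_)
      (Eventually.of_forall fun n => Eventually.of_forall fun r hr => hC r hr _ (h.bound_clamp n r))
      intervalIntegrable_const (Eventually.of_forall fun r _ => ?_)
    · exact (hf.comp (continuous_id.prodMk
        ((h.flow n).continuous_clamp h.pos))).aestronglyMeasurable
    · exact (hf.tendsto (r, v r)).comp (tendsto_const_nhds.prodMk_nhds (h.lim r))

theorem slopeField_eq_zero_of_frequently (h : IsFlowLimit T E ε u R v) {l : Filter ℝ} {t : ℝ}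
    (hl : l ≤ 𝓝 t) {y : X} (hy : Tendsto v l (𝓝 y))
    (hfr : ∃ᶠ r in l, slopeField T E r (v r) = 0) : slopeField T E t y = 0 := by
  have hp : Tendsto (fun r => (r, v r)) l (𝓝 (t, y)) :=
    (tendsto_id.mono_right hl : Tendsto (fun r : ℝ => r) l (𝓝 t)).prodMk_nhds hy
  have hlim := ((h.smooth.continuous_slopeField h.pos).tendsto (t, y)).comp hp
  simp only [Function.comp_def] at hlim
  by_contra hne
  obtain ⟨r, hr, hr'⟩ := (hfr.and_eventually (hlim.eventually_ne hne)).exists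
  exact hr' hr

theorem limitDissipated_clamp (h : IsFlowLimit T E ε u R v) (t : ℝ) :
    limitDissipated T E v (clamp T t) = limitDissipated T E v t := by
  rw [limitDissipated, clamp_clamp h.pos, h.apply_clamp, limitDissipated]

variable [FiniteDimensional ℝ X]

theorem intervalIntegrable_power (h : IsFlowLimit T E ε u R v) (a b : ℝ) :
    IntervalIntegrable (fun r => power T E (clamp T r) (v r)) volume a b :=
  (h.tendsto_integral (h.smooth.continuous_power_clamp h.pos) 0 0).1 a b

theorem tendsto_dissipated (h : IsFlowLimit T E ε u R v) (t : ℝ) :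
    Tendsto (fun n => dissipated T E (ε n) (u n) t) atTop (𝓝 (limitDissipated T E v t)) := by
  simp only [fun n => (h.flow n).dissipated_eq h.pos h.smooth (h.eps_pos n) t]
  have hE := h.smooth.continuous_clamp h.pos
  have h0 : (0 : ℝ) ∈ Icc 0 T := ⟨le_rfl, h.pos.le⟩
  refine Tendsto.sub (Tendsto.add ?_ ?_) ?_
  · exact ((h.smooth.contDiff h0).continuous.tendsto _).comp (h.lim_of_mem h0)
  · exact (h.tendsto_integral (h.smooth.continuous_power_clamp h.pos) _ _).2
  · exact (hE.tendsto (t, v t)).comp (tendsto_const_nhds.prodMk_nhds (h.lim t))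

theorem monotone (h : IsFlowLimit T E ε u R v) : Monotone (limitDissipated T E v) :=
  fun a b hab => le_of_tendsto_of_tendsto' (h.tendsto_dissipated a) (h.tendsto_dissipated b)
    fun n => ((h.flow n).dissipationBound h.pos h.smooth (h.eps_pos n)).mono hab

/-- The oscillation modulus survives the limit, so `v` is Cauchy along any filter along which `V`
converges. A general `l` covers left, right and two-sided limits. -/
theorem exists_tendsto_of_dissipated (h : IsFlowLimit T E ε u R v) {l : Filter ℝ} [l.NeBot]
    {t c : ℝ} (hl : l ≤ 𝓝 t) (hV : Tendsto (limitDissipated T E v) l (𝓝 c)) :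
    ∃ y, Tendsto v l (𝓝 y) := by
  refine cauchy_map_iff_exists_tendsto.1 (Metric.cauchy_iff.2 ⟨inferInstance, fun η hη => ?_⟩)
  obtain ⟨κ, hκ, δ, hδ, hosc⟩ := exists_oscillation_modulus
    (h.smooth.continuous_slopeField h.pos) R t (h.isolated.isolatedZeros h.pos t) (half_pos hη)
  have hlim : ∀ a b, a ≤ b → |a - t| ≤ δ → |b - t| ≤ δ →
      limitDissipated T E v b - limitDissipated T E v a < κ → ‖v b - v a‖ ≤ η / 2 := by
    intro a b hab ha hb hlt
    refine le_of_tendsto ((h.lim b).sub (h.lim a)).norm ?_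
    filter_upwards [((h.tendsto_dissipated b).sub (h.tendsto_dissipated a)).eventually
      (gt_mem_nhds hlt)] with n hn
    exact (hosc _ _ ((h.flow n).dissipationBound h.pos h.smooth (h.eps_pos n)) (h.bound_clamp n)
      a b hab ha hb hn).le
  have hS : {s | |s - t| ≤ δ ∧ |limitDissipated T E v s - c| < κ / 2} ∈ l := by
    refine inter_mem (hl ?_) ?_
    · exact Metric.closedBall_mem_nhds t hδ
    · exact hV (Metric.ball_mem_nhds c (half_pos hκ))
  refine ⟨_, image_mem_map hS, ?_⟩
  have hmain : ∀ a b, a ≤ b → (|a - t| ≤ δ ∧ |limitDissipated T E v a - c| < κ / 2) →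
      (|b - t| ≤ δ ∧ |limitDissipated T E v b - c| < κ / 2) → dist (v a) (v b) < η := by
    rintro a b hab ⟨ha, ha'⟩ ⟨hb, hb'⟩
    rw [dist_comm, dist_eq_norm]
    refine (hlim a b hab ha hb ?_).trans_lt (half_lt_self hη)
    linarith [(abs_lt.1 ha').1, (abs_lt.1 hb').2]
  rintro _ ⟨a, ha, rfl⟩ _ ⟨b, hb, rfl⟩
  rcases le_total a b with hab | hab
  · exact hmain a b hab ha hb
  · rw [dist_comm]; exact hmain b a hab hb ha

theorem exists_left_limit (h : IsFlowLimit T E ε u R v) (t : ℝ) :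
    ∃ y, Tendsto v (𝓝[<] t) (𝓝 y) :=
  h.exists_tendsto_of_dissipated nhdsWithin_le_nhds (h.monotone.tendsto_leftLim t)

theorem exists_right_limit (h : IsFlowLimit T E ε u R v) (t : ℝ) :
    ∃ y, Tendsto v (𝓝[>] t) (𝓝 y) :=
  h.exists_tendsto_of_dissipated nhdsWithin_le_nhds (h.monotone.tendsto_rightLim t)

theorem continuousAt (h : IsFlowLimit T E ε u R v) {t : ℝ}
    (ht : ContinuousAt (limitDissipated T E v) t) : ContinuousAt v t := by
  obtain ⟨y, hy⟩ := h.exists_tendsto_of_dissipated le_rfl ht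
  rw [ContinuousAt, tendsto_nhds_unique (tendsto_pure_nhds v t) (hy.mono_left (pure_le_nhds t))]
  exact hy

/-- By the definition of `dissipated`, `∫₀ᵀ ‖D𝓔‖²` equals `ε n` times the dissipated energy, which
converges. -/
theorem ae_critical (h : IsFlowLimit T E ε u R v) :
    ∀ᵐ r ∂volume, r ∈ Ioo 0 T → slopeField T E r (v r) = 0 := by
  have hf : Continuous fun p : ℝ × X => ‖slopeField T E p.1 p.2‖ ^ 2 :=
    (h.smooth.continuous_slopeField h.pos).norm.pow 2
  obtain ⟨hint, hlim⟩ := h.tendsto_integral hf 0 T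
  have hzero : Tendsto (fun n => ∫ r in (0 : ℝ)..T, ‖slopeField T E r (u n (clamp T r))‖ ^ 2)
      atTop (𝓝 0) := by
    have := h.eps_lim.mul (h.tendsto_dissipated T)
    rw [zero_mul] at this
    refine this.congr fun n => ?_
    rw [dissipated, clamp_of_mem ⟨h.pos.le, le_rfl⟩, intervalIntegral.integral_const_mul,
      mul_inv_cancel_left₀ (h.eps_pos n).ne']
  have h0 := tendsto_nhds_unique hlim hzero
  rw [intervalIntegral.integral_eq_zero_iff_of_le_of_nonneg_ae h.pos.le
    (Eventually.of_forall fun r => by simp only [Pi.zero_apply]; positivity) (hint 0 T)] at h0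
  filter_upwards [(ae_restrict_iff' measurableSet_Ioc).1 h0] with r hr hr'
  simpa using hr (Ioo_subset_Ioc_self hr')

/-- Times with critical value have full measure, so they accumulate at `t` from the left; the slope
is jointly continuous. -/
theorem left_limit_critical (h : IsFlowLimit T E ε u R v) {t : ℝ} (ht : t ∈ Ioc 0 T) {y : X}
    (hy : Tendsto v (𝓝[<] t) (𝓝 y)) : slopeField T E t y = 0 := by
  refine h.slopeField_eq_zero_of_frequently nhdsWithin_le_nhds hy fun hev => ?_
  obtain ⟨c, hc, hsub⟩ := (mem_nhdsLT_iff_exists_Ioo_subset' ht.1).1 hev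
  obtain ⟨r, hr1, hr2⟩ := (Measure.dense_of_ae h.ae_critical).inter_open_nonempty
    (Ioo (max c 0) t) isOpen_Ioo (nonempty_Ioo.2 (max_lt hc ht.1))
  exact hsub ⟨(le_max_left _ _).trans_lt hr1.1, hr1.2⟩
    (hr2 ⟨(le_max_right _ _).trans_lt hr1.1, hr1.2.trans_le ht.2⟩)

theorem right_limit_critical (h : IsFlowLimit T E ε u R v) {t : ℝ} (ht : t ∈ Ico 0 T) {y : X}
    (hy : Tendsto v (𝓝[>] t) (𝓝 y)) : slopeField T E t y = 0 := by
  refine h.slopeField_eq_zero_of_frequently nhdsWithin_le_nhds hy fun hev => ?_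
  obtain ⟨c, hc, hsub⟩ := (mem_nhdsGT_iff_exists_Ioo_subset' ht.2).1 hev
  obtain ⟨r, hr1, hr2⟩ := (Measure.dense_of_ae h.ae_critical).inter_open_nonempty
    (Ioo t (min c T)) isOpen_Ioo (nonempty_Ioo.2 (lt_min hc ht.2))
  exact hsub ⟨hr1.1, hr1.2.trans_le (min_le_left _ _)⟩
    (hr2 ⟨ht.1.trans_lt hr1.1, hr1.2.trans_le (min_le_right _ _)⟩)

theorem tendsto_limitDissipated (h : IsFlowLimit T E ε u R v) {l : Filter ℝ} {t : ℝ}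
    (hl : l ≤ 𝓝 t) {y : X} (hy : Tendsto v l (𝓝 y)) :
    Tendsto (limitDissipated T E v) l (𝓝 (E 0 (v 0) +
      (∫ r in (0 : ℝ)..clamp T t, power T E (clamp T r) (v r)) - E (clamp T t) y)) := by
  have hI : Continuous fun s => ∫ r in (0 : ℝ)..clamp T s, power T E (clamp T r) (v r) :=
    (intervalIntegral.continuous_primitive h.intervalIntegrable_power 0).comp (continuous_clamp T)
  refine Tendsto.sub (((hI.tendsto t).mono_left hl).const_add _) ?_
  have hp : Tendsto (fun r => (r, v r)) l (𝓝 (t, y)) :=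
    (tendsto_id.mono_right hl : Tendsto (fun r : ℝ => r) l (𝓝 t)).prodMk_nhds hy
  exact Tendsto.comp (g := fun p : ℝ × X => E (clamp T p.1) p.2)
    ((h.smooth.continuous_clamp h.pos).tendsto (t, y)) hp

/-- The work integral is continuous in `t`, so `V` jumps exactly by the energy drop. -/
theorem leftLim_eq (h : IsFlowLimit T E ε u R v) {t : ℝ} {y : X}
    (hy : Tendsto v (𝓝[<] t) (𝓝 y)) : Function.leftLim (limitDissipated T E v) t = E 0 (v 0) +
      (∫ r in (0 : ℝ)..clamp T t, power T E (clamp T r) (v r)) - E (clamp T t) y :=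
  leftLim_eq_of_tendsto (h.tendsto_limitDissipated nhdsWithin_le_nhds hy)

theorem rightLim_eq (h : IsFlowLimit T E ε u R v) {t : ℝ} {y : X}
    (hy : Tendsto v (𝓝[>] t) (𝓝 y)) : Function.rightLim (limitDissipated T E v) t = E 0 (v 0) +
      (∫ r in (0 : ℝ)..clamp T t, power T E (clamp T r) (v r)) - E (clamp T t) y :=
  rightLim_eq_of_tendsto (h.tendsto_limitDissipated nhdsWithin_le_nhds hy)

theorem cost_le (h : IsFlowLimit T E ε u R v) {t : ℝ} (ht : t ∈ Icc 0 T) {x y : X}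
    (hx : Tendsto v (𝓝[<] t) (𝓝 x)) (hy : Tendsto v (𝓝[>] t) (𝓝 y)) :
    cost E t x y ≤ ENNReal.ofReal (Function.rightLim (limitDissipated T E v) t -
      Function.leftLim (limitDissipated T E v) t) := by
  set V := limitDissipated T E v
  set j := Function.rightLim V t - Function.leftLim V t
  have hj : 0 ≤ j := sub_nonneg.2 (h.monotone.leftLim_le_rightLim le_rfl)
  have hg := h.smooth.continuous_slopeField_right h.pos t
  have hi := h.isolated.isolatedZeros h.pos t
  have key : ∀ η > 0, cost E t x y ≤ ENNReal.ofReal (η + ((1 + η) * (j + η) + η) + η) := by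
    intro η hη
    obtain ⟨δ, hδ, hjoin⟩ := exists_joinable_of_flow h.pos h.smooth h.isolated R t hη
    obtain ⟨σ, hσ, hnx⟩ := hi.exists_joinable_near hg x hη
    obtain ⟨σ', hσ', hny⟩ := hi.exists_joinable_near hg y hη
    obtain ⟨a, ⟨ha1, ha2⟩, ha3, ha4⟩ := (Eventually.and (Ioo_mem_nhdsLT (sub_lt_self t hδ))
      (Eventually.and (hx (Metric.ball_mem_nhds x hσ)) ((h.monotone.tendsto_leftLim t)
        (Ioi_mem_nhds (show Function.leftLim V t - η / 2 < _ by linarith))))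
      : ∀ᶠ a in 𝓝[<] t, a ∈ Ioo (t - δ) t ∧ v a ∈ Metric.ball x σ ∧
          V a ∈ Ioi (Function.leftLim V t - η / 2)).exists
    obtain ⟨b, ⟨hb1, hb2⟩, hb3, hb4⟩ := (Eventually.and (Ioo_mem_nhdsGT (lt_add_of_pos_right t hδ))
      (Eventually.and (hy (Metric.ball_mem_nhds y hσ')) ((h.monotone.tendsto_rightLim t)
        (Iio_mem_nhds (show _ < Function.rightLim V t + η / 2 by linarith))))
      : ∀ᶠ b in 𝓝[>] t, b ∈ Ioo t (t + δ) ∧ v b ∈ Metric.ball y σ' ∧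
          V b ∈ Iio (Function.rightLim V t + η / 2)).exists
    have hVab : V b - V a < j + η := by
      simp only [mem_Ioi, mem_Iio] at ha4 hb4
      linarith
    obtain ⟨n, ⟨hn1, hn2⟩, hn3⟩ := ((((h.lim a).eventually (Metric.isOpen_ball.mem_nhds ha3)).and
      ((h.lim b).eventually (Metric.isOpen_ball.mem_nhds hb3))).and
      (((h.tendsto_dissipated b).sub (h.tendsto_dissipated a)).eventually
        (gt_mem_nhds hVab))).exists
    -- When `t` is an end-point, `a` or `b` leaves `[0,T]`; clamping fixes `t` and is 1-Lipschitz,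
    -- so the times remain within `δ`.
    have hct := clamp_of_mem ht
    have hnear : ∀ s, |s - t| ≤ δ → |clamp T s - t| ≤ δ := fun s hs => by
      have := (lipschitzWith_clamp T).dist_le_mul s t
      rw [hct, Real.dist_eq, Real.dist_eq] at this
      simpa using this.trans (by simpa using hs)
    have hj2 := hjoin (ε n) (h.eps_pos n) (u n) (h.flow n) (h.bound n) (clamp T a) (clamp T b)
      (clamp_mem h.pos a).1 (clamp_mono T (ha2.trans hb1).le) (clamp_mem h.pos b).2
      (hnear a (abs_le.2 ⟨by linarith, by linarith⟩))
      (hnear b (abs_le.2 ⟨by linarith, by linarith⟩))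
    have hd : ∀ s, dissipated T E (ε n) (u n) (clamp T s) = dissipated T E (ε n) (u n) s :=
      fun s => by rw [dissipated, clamp_clamp h.pos, dissipated]
    rw [hd, hd] at hj2
    have hj2' := hj2.mono (ENNReal.ofReal_le_ofReal
      (show _ ≤ (1 + η) * (j + η) + η by gcongr))
    have hfull := ((hnx _ hn1).1.trans hj2').trans (hny _ hn2).2
    rw [slopeField_of_mem ht, ← ENNReal.ofReal_add hη.le (by positivity),
      ← ENNReal.ofReal_add (by positivity) hη.le] at hfull
    exact cost_le_of_joinable hfull
  have hc : Tendsto (fun η : ℝ => ENNReal.ofReal (η + ((1 + η) * (j + η) + η) + η)) (𝓝[>] 0)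
      (𝓝 (ENNReal.ofReal j)) := by
    refine ENNReal.tendsto_ofReal ?_
    have : Continuous fun η : ℝ => η + ((1 + η) * (j + η) + η) + η := by fun_prop
    have := this.tendsto 0
    simp only [zero_add, add_zero, one_mul] at this
    exact this.mono_left nhdsWithin_le_nhds
  exact ge_of_tendsto hc (by filter_upwards [self_mem_nhdsWithin] with η hη using key η hη)

end IsFlowLimit

end Limit

/-! ### The defect measure. -/

section Measure

/-- The Lebesgue-Stieltjes measure of a monotone function that is constant outside `[0,T]`. -/
theorem Monotone.exists_stieltjes_measure {V : ℝ → ℝ} (hV : Monotone V) {T : ℝ}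
    (h0 : ∀ s ≤ 0, V s = V 0) (hT : ∀ s ≥ T, V s = V T) :
    ∃ μ : Measure ℝ, IsFiniteMeasure μ ∧ μ (Icc 0 T)ᶜ = 0 ∧
      ∀ a b, μ (Icc a b) = ENNReal.ofReal (Function.rightLim V b - Function.leftLim V a) := by
  have hf : ⇑hV.stieltjesFunction = Function.rightLim V := funext hV.stieltjesFunction_eq
  have hleft : ∀ a, Function.leftLim hV.stieltjesFunction a = Function.leftLim V a := fun a => by
    rw [hf, leftLim_rightLim (hV.tendsto_leftLim a)]
  have hneg : ∀ x < 0, hV.stieltjesFunction x = V 0 := fun x hx => by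
    rw [hf]
    refine rightLim_eq_of_tendsto (tendsto_const_nhds.congr' ?_)
    filter_upwards [Ioo_mem_nhdsGT hx] with s hs using (h0 s hs.2.le).symm
  have hge : ∀ x ≥ T, hV.stieltjesFunction x = V T := fun x hx => by
    rw [hf]
    refine rightLim_eq_of_tendsto (tendsto_const_nhds.congr' ?_)
    filter_upwards [self_mem_nhdsWithin] with s hs using (hT s (hx.trans (le_of_lt hs))).symm
  have hleft0 : Function.leftLim V 0 = V 0 := by
    refine leftLim_eq_of_tendsto (tendsto_const_nhds.congr' ?_)
    filter_upwards [self_mem_nhdsWithin] with s hs using (h0 s (le_of_lt hs)).symm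
  have hbot : Tendsto hV.stieltjesFunction atBot (𝓝 (V 0)) :=
    tendsto_const_nhds.congr' (by
      filter_upwards [Iio_mem_atBot (0 : ℝ)] with x hx using (hneg x hx).symm)
  have htop : Tendsto hV.stieltjesFunction atTop (𝓝 (V T)) :=
    tendsto_const_nhds.congr' (by
      filter_upwards [Ici_mem_atTop T] with x hx using (hge x hx).symm)
  refine ⟨hV.stieltjesFunction.measure, hV.stieltjesFunction.isFiniteMeasure hbot htop, ?_,
    fun a b => ?_⟩
  · have hc : (Icc 0 T)ᶜ = Iio 0 ∪ Ioi T := by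
      ext x; simp only [mem_compl_iff, mem_Icc, not_and_or, not_le, mem_union, mem_Iio, mem_Ioi]
    rw [hc, measure_union_null_iff, hV.stieltjesFunction.measure_Iio hbot,
      hV.stieltjesFunction.measure_Ioi htop, hleft, hleft0, hge T le_rfl]
    simp
  · rw [StieltjesFunction.measure_Icc, hleft, hf]

end Measure

/-! ### From pointwise to integral convergence. -/

section Convergence

theorem memLp_of_norm_le_on_Ioo {X : Type*} [NormedAddCommGroup X] {T R : ℝ} (p : ℝ≥0∞) {g : ℝ → X}
    (hg : AEStronglyMeasurable g (volume.restrict (Ioo 0 T))) (hb : ∀ t ∈ Ioo 0 T, ‖g t‖ ≤ R) :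
    MemLp g p (volume.restrict (Ioo 0 T)) :=
  MemLp.of_bound hg R ((ae_restrict_iff' measurableSet_Ioo).2 (Eventually.of_forall hb))

variable {X : Type*} [NormedAddCommGroup X]
  {T : ℝ} {f : ℕ → ℝ → X} {g : ℝ → X} {R : ℝ}

theorem lpTendsto_of_bounded {p : ℝ≥0∞} (hp : 1 ≤ p) (hp' : p ≠ ∞)
    (hf : ∀ n, AEStronglyMeasurable (f n) (volume.restrict (Ioo 0 T)))
    (hg : AEStronglyMeasurable g (volume.restrict (Ioo 0 T)))
    (hb : ∀ n, ∀ t ∈ Ioo 0 T, ‖f n t‖ ≤ R) (hgb : ∀ t ∈ Ioo 0 T, ‖g t‖ ≤ R)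
    (hlim : ∀ t ∈ Ioo 0 T, Tendsto (fun n => f n t) atTop (𝓝 (g t))) :
    LpTendsto T p f g := by
  refine ⟨fun n => memLp_of_norm_le_on_Ioo p (hf n) (hb n), memLp_of_norm_le_on_Ioo p hg hgb,
    tendsto_Lp_finite_of_tendsto_ae hp hp' hf (memLp_of_norm_le_on_Ioo p hg hgb) ?_
      ((ae_restrict_iff' measurableSet_Ioo).2 (Eventually.of_forall hlim))⟩
  -- Above the level `R + 1` the truncated functions vanish, so uniform integrability is trivial.
  refine unifIntegrable_of hp hp' hf fun η _ => ⟨(R + 1).toNNReal, fun n => ?_⟩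
  have hz : {t | (R + 1).toNNReal ≤ ‖f n t‖₊}.indicator (f n)
      =ᵐ[volume.restrict (Ioo 0 T)] 0 := by
    refine (ae_restrict_iff' measurableSet_Ioo).2 (Eventually.of_forall fun t ht => ?_)
    refine indicator_of_notMem (fun hmem => ?_) _
    have h1 : R + 1 ≤ ‖f n t‖ :=
      (Real.le_coe_toNNReal _).trans (NNReal.coe_le_coe.2 hmem)
    linarith [hb n t ht]
  rw [eLpNorm_congr_ae hz]
  simp

variable [InnerProductSpace ℝ X]

theorem weakStarTendsto_of_bounded
    (hf : ∀ n, AEStronglyMeasurable (f n) (volume.restrict (Ioo 0 T)))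
    (hg : AEStronglyMeasurable g (volume.restrict (Ioo 0 T)))
    (hb : ∀ n, ∀ t ∈ Ioo 0 T, ‖f n t‖ ≤ R) (hgb : ∀ t ∈ Ioo 0 T, ‖g t‖ ≤ R)
    (hlim : ∀ t ∈ Ioo 0 T, Tendsto (fun n => f n t) atTop (𝓝 (g t))) :
    WeakStarTendsto T f g := by
  refine ⟨fun n => memLp_of_norm_le_on_Ioo ∞ (hf n) (hb n), memLp_of_norm_le_on_Ioo ∞ hg hgb,
    fun φ hφ => ?_⟩
  refine tendsto_integral_of_dominated_convergence (fun t => R * ‖φ t‖)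
    (fun n => (hf n).inner hφ.aestronglyMeasurable) (hφ.norm.const_mul R) (fun n => ?_) ?_
  · refine (ae_restrict_iff' measurableSet_Ioo).2 (Eventually.of_forall fun t ht => ?_)
    exact (norm_inner_le_norm _ _).trans (mul_le_mul_of_nonneg_right (hb n t ht) (norm_nonneg _))
  · exact (ae_restrict_iff' measurableSet_Ioo).2 (Eventually.of_forall fun t ht =>
      (hlim t ht).inner tendsto_const_nhds)

end Convergence

/-! ### Assembly of the limit solution. -/

section Main

variable {X : Type*} [NormedAddCommGroup X] [InnerProductSpace ℝ X] [CompleteSpace X]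
  [FiniteDimensional ℝ X]
  {T : ℝ} {E : ℝ → X → ℝ} {ε : ℕ → ℝ} {u : ℕ → ℝ → X} {R : ℝ} {v : ℝ → X}

namespace IsFlowLimit

theorem isDissipativeViscositySolution (h : IsFlowLimit T E ε u R v) :
    IsDissipativeViscositySolution T E v := by
  have hT := h.pos
  choose vm hvm using h.exists_left_limit
  choose vp hvp using h.exists_right_limit
  set V := limitDissipated T E v
  have hV : Monotone V := h.monotone
  have hVc : ∀ t, V (clamp T t) = V t := h.limitDissipated_clamp
  obtain ⟨μ, hμfin, hμc, hμ⟩ := hV.exists_stieltjes_measure (T := T)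
    (fun s hs => by
      rw [← hVc s, clamp_of_nonpos hs])
    (fun s hs => by
      rw [← hVc s, clamp_of_ge hT hs])
  have hμs : ∀ t, μ {t} = ENNReal.ofReal (Function.rightLim V t - Function.leftLim V t) :=
    fun t => by rw [← Icc_self, hμ]
  have hI : ∀ a b : ℝ, a ∈ Icc 0 T → b ∈ Icc 0 T →
      ∫ r in a..b, power T E r (v r) = ∫ r in a..b, power T E (clamp T r) (v r) := by
    intro a b ha hb
    refine intervalIntegral.integral_congr fun r hr => ?_
    simp only [clamp_of_mem (uIcc_subset_Icc ha hb hr)]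
  have hnonneg : ∀ a b, a ≤ b → 0 ≤ Function.rightLim V b - Function.leftLim V a :=
    fun a b hab => sub_nonneg.2 (hV.leftLim_le_rightLim hab)
  have hjump : ∀ t ∈ Icc 0 T,
      Function.rightLim V t - Function.leftLim V t = E t (vm t) - E t (vp t) := by
    intro t ht
    rw [h.rightLim_eq (hvp t), h.leftLim_eq (hvm t), clamp_of_mem ht]
    ring
  have hmem : ∀ t ∈ atoms μ, t ∈ Icc 0 T := by
    intro t ht
    by_contra hne
    exact ht (measure_mono_null (singleton_subset_iff.2 hne) hμc)
  have hcont : ∀ t, t ∉ atoms μ → ContinuousAt V t := by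
    intro t ht
    have h0 : μ {t} = 0 := not_not.1 ht
    rw [hμs, ENNReal.ofReal_eq_zero] at h0
    rw [hV.continuousAt_iff_leftLim_eq_rightLim]
    linarith [hnonneg t t le_rfl]
  have hoff : ∀ t, t ∉ atoms μ → vm t = v t ∧ vp t = v t := by
    intro t ht
    have hc := h.continuousAt (hcont t ht)
    exact ⟨tendsto_nhds_unique (hvm t) (hc.mono_left nhdsWithin_le_nhds),
      tendsto_nhds_unique (hvp t) (hc.mono_left nhdsWithin_le_nhds)⟩
  have hat : ∀ t ∈ atoms μ, (μ {t}).toReal = E t (vm t) - E t (vp t) := by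
    intro t ht
    rw [hμs, ENNReal.toReal_ofReal (hnonneg t t le_rfl), hjump t (hmem t ht)]
  -- The two cost estimates meet because the atom is both the jump of `V` and the energy drop.
  have hcost : ∀ t ∈ atoms μ, cost E t (vm t) (vp t) = μ {t} := by
    intro t ht
    have htm := hmem t ht
    refine le_antisymm ?_ ?_
    · rw [hμs]
      exact h.cost_le htm (hvm t) (hvp t)
    · rw [hμs, hjump t htm]
      exact ofReal_sub_le_cost (h.smooth.contDiff htm) _ _
  have hleftcrit : ∀ s ∈ Ioc 0 T, vm s ∈ criticalSet E s := by
    intro s hs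
    have := h.left_limit_critical hs (hvm s)
    rwa [slopeField_of_mem (Ioc_subset_Icc_self hs)] at this
  have hrightcrit : ∀ t ∈ Ico 0 T, vp t ∈ criticalSet E t := by
    intro s hs
    have := h.right_limit_critical hs (hvp s)
    rwa [slopeField_of_mem (Ico_subset_Icc_self hs)] at this
  refine ⟨vm, vp, μ, ?_⟩
  exact {
    measurable := h.stronglyMeasurable.comp_measurable measurable_subtype_coe
    bounded := ⟨R, fun t _ => h.norm_le t⟩
    left_limit := fun s _ => hvm s
    right_limit := fun t _ => hvp t
    -- Freezing before time `0` makes the left limit there equal to the initial value, which is the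
    -- stated convention; likewise at `T`.
    left_zero := by
      refine tendsto_nhds_unique (hvm 0) (tendsto_const_nhds.congr' ?_)
      filter_upwards [self_mem_nhdsWithin] with s hs
      rw [← h.apply_clamp s, clamp_of_nonpos (le_of_lt hs)]
    right_end := by
      refine tendsto_nhds_unique (hvp T) (tendsto_const_nhds.congr' ?_)
      filter_upwards [self_mem_nhdsWithin] with s hs
      rw [← h.apply_clamp s, clamp_of_ge hT (le_of_lt hs)]
    finite := hμfin
    concentrated := hμc
    countable_atoms := by
      have hsub : atoms μ ⊆ {t | ¬ContinuousAt V t} := by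
        intro t ht hc
        refine ht ?_
        rw [hμs, hV.continuousAt_iff_leftLim_eq_rightLim.1 hc]
        simp
      exact hV.countable_not_continuousAt.mono hsub
    power_integrable := by
      refine (h.intervalIntegrable_power 0 T).congr fun r hr => ?_
      rw [uIoc_of_le hT.le] at hr
      simp only [clamp_of_mem (Ioc_subset_Icc_self hr)]
    energy_identity := fun s t hs hst ht => by
      have hsm : s ∈ Icc 0 T := ⟨hs, hst.trans ht⟩
      have htm : t ∈ Icc 0 T := ⟨hs.trans hst, ht⟩
      rw [hμ, ENNReal.toReal_ofReal (hnonneg s t hst), h.rightLim_eq (hvp t),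
        h.leftLim_eq (hvm s), clamp_of_mem hsm, clamp_of_mem htm, hI s t hsm htm,
        ← intervalIntegral.integral_interval_sub_left (h.intervalIntegrable_power 0 t)
          (h.intervalIntegrable_power 0 s)]
      ring
    continuous_off_atoms := fun t ht => (h.continuousAt (hcont t ht.2)).continuousWithinAt
    critical_off_atoms := fun t ht => (hoff t ht.2).1 ▸ hleftcrit t ht.1
    left_critical := hleftcrit
    right_critical := hrightcrit
    atoms_eq_jumps := by
      ext t
      refine ⟨fun ht => ⟨hmem t ht, fun heq => ?_⟩, fun ht => ?_⟩
      · have := hat t ht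
        rw [heq, sub_self, ENNReal.toReal_eq_zero_iff] at this
        exact this.elim ht (measure_ne_top μ _)
      · by_contra hna
        exact ht.2 ((hoff t hna).1.trans (hoff t hna).2.symm)
    jump_pos := fun t ht => by
      rw [hcost t ht]
      exact pos_iff_ne_zero.2 ht
    jump_cost := hcost
    jump_energy := hat }

end IsFlowLimit

theorem IsGradientFlow.exists_dissipated_bound (hT : 0 < T) (hE : SmoothEnergy T E) (R : ℝ) :
    ∃ M, ∀ ε > 0, ∀ u, IsGradientFlow T E ε u → (∀ t ∈ Icc 0 T, ‖u t‖ ≤ R) →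
      ∀ t, |dissipated T E ε u t| ≤ M := by
  have : ProperSpace X := FiniteDimensional.proper_real X
  have hK : IsCompact (Icc 0 T ×ˢ Metric.closedBall (0 : X) R) :=
    isCompact_Icc.prod (isCompact_closedBall 0 R)
  obtain ⟨B, hB⟩ := hK.exists_bound_of_continuousOn (hE.continuous_clamp hT).continuousOn
  obtain ⟨P, hP⟩ := hK.exists_bound_of_continuousOn (hE.continuous_power_clamp hT).continuousOn
  refine ⟨B + |P| * T + B, fun ε hε u hu hR t => ?_⟩
  have ht := clamp_mem hT t
  have h0 : (0 : ℝ) ∈ Icc 0 T := ⟨le_rfl, hT.le⟩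
  have b0 := hB (0, u 0) ⟨h0, by simpa using hR 0 h0⟩
  have bt := hB (clamp T t, u (clamp T t)) ⟨ht, by simpa using hR _ ht⟩
  simp only [clamp_of_mem h0, clamp_clamp hT, Real.norm_eq_abs] at b0 bt
  have bI : |∫ r in (0 : ℝ)..clamp T t, power T E (clamp T r) (u (clamp T r))| ≤ |P| * T := by
    rw [← Real.norm_eq_abs]
    refine (intervalIntegral.norm_integral_le_of_norm_le_const (C := |P|) fun r hr => ?_).trans ?_
    · rw [uIoc_of_le ht.1] at hr
      have hr' : r ∈ Icc 0 T := ⟨hr.1.le, hr.2.trans ht.2⟩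
      exact (hP (r, u (clamp T r)) ⟨hr', by simpa using hR _ (clamp_mem hT r)⟩).trans (le_abs_self P)
    · rw [sub_zero, abs_of_nonneg ht.1]
      exact mul_le_mul_of_nonneg_left ht.2 (abs_nonneg P)
  rw [hu.dissipated_eq hT hE hε]
  rw [abs_le] at *
  constructor <;> linarith [b0.1, b0.2, bt.1, bt.2, bI.1, bI.2]

end Main

theorem theorem1 {X : Type*} [NormedAddCommGroup X] [InnerProductSpace ℝ X] [CompleteSpace X]
    [FiniteDimensional ℝ X] (T : ℝ) (hT : 0 < T) (E : ℝ → X → ℝ)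
    (hE0 : SmoothEnergy T E) (hE1 : Coercive T E) (hE2 : PowerControl T E)
    (hE3 : IsolatedCriticalPoints T E)
    (ε : ℕ → ℝ) (hεpos : ∀ n, 0 < ε n) (hε : Tendsto ε atTop (𝓝 0))
    (u₀ : X) (u₀n : ℕ → X) (hu₀ : Tendsto u₀n atTop (𝓝 u₀))
    (un : ℕ → ℝ → X) (hun : ∀ n, IsGradientFlow T E (ε n) (un n))
    (hinit : ∀ n, un n 0 = u₀n n) :
    ∃ (k : ℕ → ℕ) (u : ℝ → X), StrictMono k ∧
      (∀ t ∈ Icc 0 T, Tendsto (fun n => un (k n) t) atTop (𝓝 (u t))) ∧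
      WeakStarTendsto T (fun n => un (k n)) u ∧
      (∀ p : ℝ≥0∞, 1 ≤ p → p ≠ ∞ → LpTendsto T p (fun n => un (k n)) u) ∧
      u 0 = u₀ ∧
      IsDissipativeViscositySolution T E u := by
  have h0 : (0 : ℝ) ∈ Icc 0 T := ⟨le_rfl, hT.le⟩
  -- Initial energies converge, hence are bounded.
  obtain ⟨A, hA⟩ := (((hE0.contDiff h0).continuous.tendsto u₀).comp hu₀).bddAbove_range
  obtain ⟨R, hR⟩ := exists_norm_bound_of_initial_energy hT hE0 hE1 hE2 A
  have hbound : ∀ n, ∀ t ∈ Icc 0 T, ‖un n t‖ ≤ R := fun n =>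
    hR (ε n) (hεpos n) (un n) (hun n) (by rw [hinit]; exact hA ⟨n, rfl⟩)
  obtain ⟨M, hM⟩ := IsGradientFlow.exists_dissipated_bound hT hE0 R
  obtain ⟨k, v, hk, hlim⟩ := exists_subseq_tendsto_of_dissipationBound
    (hE0.continuous_slopeField hT) (hE3.isolatedZeros hT)
    (fun n => (hun n).dissipationBound hT hE0 (hεpos n))
    (fun n r => hbound n _ (clamp_mem hT r))
    (fun n r => hM (ε n) (hεpos n) (un n) (hun n) (hbound n) r)
  have h : IsFlowLimit T E (fun n => ε (k n)) (fun n => un (k n)) R v :=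
    { pos := hT
      smooth := hE0
      isolated := hE3
      eps_pos := fun n => hεpos (k n)
      eps_lim := hε.comp hk.tendsto_atTop
      flow := fun n => hun (k n)
      bound := fun n => hbound (k n)
      lim := hlim }
  have hmeas : ∀ n, AEStronglyMeasurable (un (k n)) (volume.restrict (Ioo 0 T)) := fun n =>
    (((hun (k n)).continuousOn hT).mono Ioo_subset_Icc_self).aestronglyMeasurable
      measurableSet_Ioo
  have hlim' : ∀ t ∈ Ioo 0 T, Tendsto (fun n => un (k n) t) atTop (𝓝 (v t)) :=
    fun t ht => h.lim_of_mem (Ioo_subset_Icc_self ht)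
  have hb : ∀ n, ∀ t ∈ Ioo 0 T, ‖un (k n) t‖ ≤ R := fun n t ht =>
    hbound (k n) t (Ioo_subset_Icc_self ht)
  have hvmeas : AEStronglyMeasurable v (volume.restrict (Ioo 0 T)) :=
    h.stronglyMeasurable.aestronglyMeasurable
  refine ⟨k, v, hk, fun t ht => h.lim_of_mem ht,
    weakStarTendsto_of_bounded hmeas hvmeas hb (fun t _ => h.norm_le t) hlim',
    fun p hp hp' => lpTendsto_of_bounded hp hp' hmeas hvmeas hb (fun t _ => h.norm_le t) hlim', ?_,
    h.isDissipativeViscositySolution⟩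
  refine tendsto_nhds_unique (h.lim_of_mem h0) ?_
  simp only [hinit]
  exact hu₀.comp hk.tendsto_atTop
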